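/- Let $k$ be an algebraically closed field and let $n \ge 1$, $d \ge 1$ be integers. Let $\mathscr F$ be a codimension one distribution on $\mathbb P^n = \mathbb P^n_k$, that is, a coherent subsheaf $T_{\mathscr F} \subset T\mathbb P^n$ of rank $n-1$ with torsion-free quotient. Suppose that $\mathscr F$ has degree $d$, which means that it is defined by a global section $\omega$ of $\Omega^1_{\mathbb P^n}(d+2)$: the zero locus of $\omega$ has codimension at least two, and $T_{\mathscr F}$ is the kernel of the contraction $\omega\colon T\mathbb P^n \to \mathcal O_{\mathbb P^n}(d+2)$. Let $Z \subset \mathbb P^n$ be the singular scheme of $\mathscr F$, that is, the closed subscheme whose ideal sheaf $\mathcal I_Z$ is the image of the map $$\Omega^{n-1}_{\mathbb P^n} \otimes \det(T_{\mathscr F}) \longrightarrow \mathcal O_{\mathbb P^n}, \qquad \det(T_{\mathscr F}) = \Big(\bigwedge\nolimits^{n-1} T_{\mathscr F}\Big)^{\vee\vee},$$ induced by the dual $\Omega^1_{\mathbb P^n} \to T_{\mathscr F}^\vee$ of the inclusion. If $Z$ is zero-dimensional, then $H^0(\mathbb P^n, \mathcal I_Z(d)) = 0$, and $Z$ is not contained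 in any hypersurface of degree $\le d$: for every $e \le d$, no nonzero form of degree $e$ in $n+1$ variables vanishes on the scheme $Z$. -/

import Mathlib

open CategoryTheory AlgebraicGeometry

universe u

noncomputable section

attribute [local instance] MvPolynomial.gradedAlgebra

/-! ### The singular ideal over an affine open -/

namespace Dist

section Affine

variable {k A : Type u} [Field k] [CommRing A] [Algebra k A]

/-- The map `φ^∨ : Ω¹ → T^∨` dual to the inclusion `φ : T → TX` of a submodule of the module of
derivations. It sends `α` to the functional `v ↦ ⟨α, v⟩`. -/
def dualMap (T : Submodule A (Derivation k A A)) :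
    KaehlerDifferential k A →ₗ[A] Module.Dual A T :=
  ((KaehlerDifferential.linearMapEquivDerivation k A (M := A)).symm.toLinearMap ∘ₗ
    T.subtype).flip

/-- The map `Ω^m → ⋀^m (T^∨) → (⋀^m T)^∨` induced by `φ^∨`. When `T` is a reflexive module of
rank `m`, the target is the dual `det(T)^∨` of the determinant of `T`. -/
def formMap (T : Submodule A (Derivation k A A)) (m : ℕ) :
    ⋀[A]^m (KaehlerDifferential k A) →ₗ[A] Module.Dual A (⋀[A]^m T) :=
  exteriorPower.pairingDual A T m ∘ₗ exteriorPower.map m (dualMap T)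

/-- The image of the map `Ω^m ⊗ det(T) → A`, where `det(T) = (⋀^m T)^∨∨` and the map is
the one above followed by the evaluation `det(T)^∨ ⊗ det(T) → A`. -/
def singularIdeal (T : Submodule A (Derivation k A A)) (m : ℕ) : Ideal A :=
  LinearMap.range (TensorProduct.lift
    ((Module.Dual.eval A (Module.Dual A (⋀[A]^m T))) ∘ₗ formMap T m))

end Affine

/-! ### Distributions on a scheme over a field -/

variable {k : Type u} [Field k] {X : Scheme.{u}}

/-- The `k`-algebra structure on the sections over an open set `U` of a scheme over `Spec k`. -/
@[reducible] def sectionAlgebra (p : X ⟶ Spec (.of k)) (U : X.Opens) : Algebra k Γ(X, U) :=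
  ((p.appLE ⊤ U le_top).hom.comp (Scheme.ΓSpecIso (.of k)).inv.hom).toAlgebra

/-- The sections over `U` of the tangent sheaf of `X` over `k`, for `U` an affine open of a scheme
`X` that is locally of finite type over `k`: the `k`-derivations of `Γ(X, U)`. -/
abbrev TangentSections (p : X ⟶ Spec (.of k)) (U : X.Opens) : Type u :=
  letI := sectionAlgebra p U
  Derivation k Γ(X, U) Γ(X, U)

/-- The restriction of functions from `U` to `V ≤ U`. -/
abbrev res {U V : X.Opens} (h : V ≤ U) : Γ(X, U) →+* Γ(X, V) :=
  (X.presheaf.map (homOfLE h).op).hom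

/-- A distribution of rank `m` on `X` over `k`, up to isomorphism: a quasi-coherent subsheaf
`T` of the tangent sheaf with torsion-free quotient and of rank `m`. As in
`AlgebraicGeometry.Scheme.IdealSheafData`, the subsheaf is given by its sections over the affine
opens, subject to `T(D(g)) = T(U)_g` for every `g ∈ Γ(X, U)`: the derivation `w` of `Γ(X, D(g))`
belongs to the left-hand side if and only if some `g ^ N • w` is the extension of a derivation
`v ∈ T(U)`, that is, agrees with `v` on the functions that come from `U`.

On a smooth variety `X` of dimension `N` this is a distribution of codimension `N - m`: the
inclusion `T ⊆ TX` and the quotient map make up the exact sequence `0 → T → TX → TX/T → 0`. -/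
structure Distribution (p : X ⟶ Spec (.of k)) (m : ℕ) where
  /-- The sections of the tangent sheaf of the distribution. -/
  tangent : ∀ U : X.affineOpens, Submodule Γ(X, U) (TangentSections p U.1)
  mem_basicOpen_iff : ∀ (U : X.affineOpens) (g : Γ(X, U))
    (w : TangentSections p (X.affineBasicOpen g).1),
    w ∈ tangent (X.affineBasicOpen g) ↔
      ∃ N : ℕ, ∃ v ∈ tangent U, ∀ a : Γ(X, U),
        res (V := (X.affineBasicOpen g).1) (X.basicOpen_le g) g ^ N *
            w (res (V := (X.affineBasicOpen g).1) (X.basicOpen_le g) a) =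
          res (V := (X.affineBasicOpen g).1) (X.basicOpen_le g) (v a)
  /-- The normal sheaf is torsion free. -/
  torsionFree : ∀ U : X.affineOpens,
    Module.IsTorsionFree Γ(X, U) (TangentSections p U.1 ⧸ tangent U)
  /-- The tangent sheaf has rank `m`. -/
  rank_eq : ∀ U : X.affineOpens, (U.1 : Set X).Nonempty →
    Module.finrank Γ(X, U) (tangent U) = m

/-- The closed subscheme `i : Z ⟶ X` is the singular scheme of the distribution: its ideal sheaf
is the image of `Ω^m ⊗ det(T) → 𝒪_X`. -/
def Distribution.IsSingularScheme {p : X ⟶ Spec (.of k)} {m : ℕ} (D : Distribution p m)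
    {Z : Scheme.{u}} (i : Z ⟶ X) : Prop :=
  ∀ U : X.affineOpens,
    letI := sectionAlgebra p U.1
    i.ker.ideal U = singularIdeal (D.tangent U) m

/-! ### Projective space -/

section ProjectiveSpace

variable (k : Type u) [Field k] (n : ℕ)

/-- The homogeneous coordinate ring `k[x_0, …, x_n]`, by its graded pieces. -/
abbrev forms : ℕ → Submodule k (MvPolynomial (Fin (n + 1)) k) :=
  MvPolynomial.homogeneousSubmodule (Fin (n + 1)) k

/-- The projective space `ℙⁿ` over `k`. -/
abbrev projectiveSpace : Scheme.{u} := Proj (forms k n)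

/-- The structure morphism of `ℙⁿ`. -/
def projectiveSpaceOver : projectiveSpace k n ⟶ Spec (.of k) :=
  Proj.toSpecZero (forms k n) ≫ Spec.map (CommRingCat.ofHom (algebraMap k (forms k n 0)))

variable {k n}

/-- The coordinate `x_i`. -/
abbrev coord (i : Fin (n + 1)) : MvPolynomial (Fin (n + 1)) k := MvPolynomial.X i

theorem coord_mem (i : Fin (n + 1)) : (coord i : MvPolynomial (Fin (n + 1)) k) ∈ forms k n 1 :=
  MvPolynomial.isHomogeneous_X k i

variable (k) in
/-- The standard affine open `U_i = D₊(x_i)`. -/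
abbrev chart (i : Fin (n + 1)) : (projectiveSpace k n).affineOpens :=
  ⟨Proj.basicOpen (forms k n) (coord i),
    Proj.isAffineOpen_basicOpen (forms k n) (coord i) (coord_mem i) one_pos⟩

/-- The function `F / x_i ^ e` on `U_i`, for a form `F` of degree `e`. -/
def dehomogenize {e : ℕ} (F : forms k n e) (i : Fin (n + 1)) :
    Γ(projectiveSpace k n, (chart k i).1) :=
  Proj.awayToSection (forms k n) (coord i)
    (HomogeneousLocalization.Away.mk (forms k n) (coord_mem i) e F.1
      (by simpa only [smul_eq_mul, mul_one] using F.2))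

/-- The function `x_j / x_i` on `U_i`. -/
def ratio (i j : Fin (n + 1)) : Γ(projectiveSpace k n, (chart k i).1) :=
  dehomogenize (e := 1) ⟨coord j, coord_mem j⟩ i

variable (k n) in
/-- A twisted `1`-form `ω = F_0 dx_0 + ⋯ + F_n dx_n` of degree `d + 2`: the `F_j` are forms of
degree `d + 1`, and the contraction `x_0 F_0 + ⋯ + x_n F_n` with the radial vector field vanishes.
By the Euler sequence these are the global sections of `Ω¹(d + 2)`. -/
structure TwistedOneForm (d : ℕ) where
  coeff : Fin (n + 1) → forms k n (d + 1)
  radial : ∑ j, coord j * (coeff j).1 = 0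

/-- The contraction of `ω` with a vector field `v` over `U_i`, where `𝒪(d + 2)` is trivialized by
`x_i ^ (d + 2)`: on `U_i` the form `ω / x_i ^ (d + 2)` is `∑_j (F_j / x_i ^ (d + 1)) d(x_j / x_i)`,
the term with `j = i` being zero. -/
def TwistedOneForm.contract {d : ℕ} (ω : TwistedOneForm k n d) (i : Fin (n + 1))
    (v : TangentSections (projectiveSpaceOver k n) (chart k i).1) :
    Γ(projectiveSpace k n, (chart k i).1) :=
  ∑ j, dehomogenize (ω.coeff j) i * v (ratio i j)

/-- The distribution has degree `d`: it is defined by a global section `ω` of `Ω¹(d + 2)`, that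
is, by an `ω` whose zero locus has codimension at least two (the coefficients of `ω` have no
common factor), and the tangent sheaf is the kernel of the contraction with `ω`. -/
def Distribution.HasDegree {m : ℕ} (D : Distribution (projectiveSpaceOver k n) m) (d : ℕ) :
    Prop :=
  ∃ ω : TwistedOneForm k n d,
    (∀ g : MvPolynomial (Fin (n + 1)) k, (∀ j, g ∣ (ω.coeff j).1) → IsUnit g) ∧
    ∀ (i : Fin (n + 1)) (v : TangentSections (projectiveSpaceOver k n) (chart k i).1),
      v ∈ D.tangent (chart k i) ↔ ω.contract i v = 0

/-- The space `H⁰(ℙⁿ, I(e))` of global sections of the twist `I(e) ⊆ 𝒪(e)` of an ideal sheaf `I`.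
With `𝒪(e)` trivialized by `x_i ^ e` over `U_i`, a section is a family of functions
`s_i ∈ I(U_i)` such that `s_i = (x_j / x_i) ^ e s_j` over `U_i ∩ U_j`. -/
def twistedSections (I : (projectiveSpace k n).IdealSheafData) (e : ℕ) :
    AddSubgroup (∀ i : Fin (n + 1), Γ(projectiveSpace k n, (chart k i).1)) where
  carrier := {s | (∀ i, s i ∈ I.ideal (chart k i)) ∧ ∀ i j,
    res (inf_le_left : (chart k i).1 ⊓ (chart k j).1 ≤ _) (s i) =
      res (inf_le_left : (chart k i).1 ⊓ (chart k j).1 ≤ _) (ratio i j) ^ e *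
        res (inf_le_right : (chart k i).1 ⊓ (chart k j).1 ≤ _) (s j)}
  zero_mem' := ⟨fun i => zero_mem _, fun i j => by simp⟩
  add_mem' {s t} hs ht := ⟨fun i => add_mem (hs.1 i) (ht.1 i), fun i j => by
    rw [Pi.add_apply, Pi.add_apply, map_add, map_add, mul_add, hs.2 i j, ht.2 i j]⟩
  neg_mem' {s} hs := ⟨fun i => neg_mem (hs.1 i), fun i j => by
    rw [Pi.neg_apply, Pi.neg_apply, map_neg, map_neg, mul_neg, hs.2 i j]⟩

/-- The closed subscheme with ideal sheaf `I` is contained in the hypersurface `F = 0`, the ideal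
sheaf of which is generated over `U_i` by `F / x_i ^ e`. -/
def IsContainedInHypersurface (I : (projectiveSpace k n).IdealSheafData) {e : ℕ}
    (F : forms k n e) : Prop :=
  ∀ i, dehomogenize F i ∈ I.ideal (chart k i)

end ProjectiveSpace

end Dist

end

open RingTheory.Sequence IsLocalRing

attribute [local instance] MvPolynomial.gradedAlgebra

/-! Write `ω = ∑ F_j dx_j` with forms `F_j` of degree `d + 1`, so `∑ x_j F_j = 0`. On each chart the
ideal of `Z` lies in the ideal of the dehomogenized `F_j` (`singularIdeal_le`, a Cramer-type
argument using that the `F_j` have no common factor). Hence the common zeros of the `F_j` lie in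
`Z`, and a form `G` of degree `d` vanishing on `Z` satisfies `x_j ^ N * G ∈ (F_0, …, F_n)` for every
`j`. It remains to show `G = 0` (`eq_zero_of_pow_mul_mem_span`).

As the zeros are isolated, some linear form `ℓ` avoids them, and `(ℓ, F_0, …, F_n)` is primary to
the origin. The local ring at the origin has depth `n + 1`, so `ℓ` and `n` general `k`-combinations
`F_{v_1}, …, F_{v_n}` of the `F_j` form a regular sequence. Given `u ≠ 0`, the `v_i` can be chosen
to make a basis together with `u`; let `a` be the coordinate dual to `u`. Modulo `I = (F_{v_1}, …,
F_{v_n})` each `F_w` is `a(w) F_u`, so `∑ x_j F_j = 0` becomes `q F_u ∈ I` with `q = ∑ a(e_j) x_j`.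
Thus `q F_j ∈ I` for all `j`, then `ℓ ^ N q G ∈ I`, and since `ℓ` is regular modulo `I`, `q G ∈ I`
locally. As `q G` has the degree of the generators, it is a `k`-combination of the `F_j`
(`linear_mul_mem_range`).

The linear forms `q` with `q G` in the span of the `F_j` make up a vector space. By the above it
contains, for each `u ≠ 0`, some `q` with `q(u) = 1`, so it is the space of all linear forms. Both
`x_0 G, …, x_n G` and `F_0, …, F_n` then span the same space, by dimension; so a nonzero `G` divides
all the `F_j` and is a unit, contrary to `d ≥ 1`. -/

/-! ### Prolonging regular sequences in a Noetherian local ring. -/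

theorem exists_isSMulRegular_and {R : Type*} [CommRing R] [IsNoetherianRing R] (I : Ideal R)
    {M N : Type*} [AddCommGroup M] [Module R M] [Module.Finite R M]
    [AddCommGroup N] [Module R N] [Module.Finite R N]
    {x y : R} (hx : x ∈ I) (hy : y ∈ I) (hxM : IsSMulRegular M x) (hyN : IsSMulRegular N y) :
    ∃ c ∈ I, IsSMulRegular M c ∧ IsSMulRegular N c := by
  by_contra! H
  have hsub : (I : Set R) ⊆ ⋃ p ∈ associatedPrimes R M ∪ associatedPrimes R N, (p : Set R) := by
    intro c hc
    rw [Set.biUnion_union, biUnion_associatedPrimes_eq_compl_regular,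
      biUnion_associatedPrimes_eq_compl_regular]
    by_cases h : IsSMulRegular M c
    · exact Or.inr (H c hc h)
    · exact Or.inl h
  obtain ⟨p, hp, hIp⟩ := (Ideal.subset_union_prime_finite
    ((associatedPrimes.finite R M).union (associatedPrimes.finite R N)) (f := id) 0 0
    (by rintro p (hp | hp) _ _ <;> exact hp.isPrime)).1 hsub
  rcases hp with hp | hp
  · have : x ∈ ⋃ p ∈ associatedPrimes R M, (p : Set R) := Set.mem_biUnion hp (hIp hx)
    rw [biUnion_associatedPrimes_eq_compl_regular] at this
    exact this hxM
  · have : y ∈ ⋃ p ∈ associatedPrimes R N, (p : Set R) := Set.mem_biUnion hp (hIp hy)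
    rw [biUnion_associatedPrimes_eq_compl_regular] at this
    exact this hyN

/-- Depth does not depend on the regular element divided out. Otherwise the maximal ideal kills the
class of some `u ∉ yN`; with `c u = y u'` and `e u = y v` one gets `e u' = c v`, so `u' = c w` and
`u = y w`. -/
theorem exists_isSMulRegular_quotSMulTop {R : Type*} [CommRing R] [IsLocalRing R]
    [IsNoetherianRing R] {N : Type*} [AddCommGroup N] [Module R N] [Module.Finite R N]
    {c e y : R} (hc : c ∈ maximalIdeal R) (he : e ∈ maximalIdeal R) (hcN : IsSMulRegular N c)
    (hyN : IsSMulRegular N y) (hce : IsSMulRegular (QuotSMulTop c N) e) :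
    ∃ z ∈ maximalIdeal R, IsSMulRegular (QuotSMulTop y N) z := by
  by_contra! H
  have hsub : (maximalIdeal R : Set R) ⊆
      ⋃ p ∈ associatedPrimes R (QuotSMulTop y N), (p : Set R) := by
    rw [biUnion_associatedPrimes_eq_compl_regular]
    exact H
  obtain ⟨p, hp, hIp⟩ := (Ideal.subset_union_prime_finite
    (associatedPrimes.finite R (QuotSMulTop y N)) (f := id) 0 0
    (by rintro p hp _ _; exact hp.isPrime)).1 hsub
  obtain ⟨hpr, u, hu⟩ := Submodule.isAssociatedPrime_iff.1 hp
  obtain ⟨u, rfl⟩ := Submodule.Quotient.mk_surjective _ u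
  have hmem (N' : Type _) [AddCommGroup N'] [Module R N'] (a : R) (v : N') :
      (Submodule.Quotient.mk v : QuotSMulTop a N') = 0 ↔ ∃ w, a • w = v := by
    rw [Submodule.Quotient.mk_eq_zero, Submodule.mem_smul_pointwise_iff_exists]
    simp
  have hmu (a : R) (ha : a ∈ maximalIdeal R) : ∃ w, y • w = a • u := by
    have : a ∈ p := hIp ha
    rw [hu, Submodule.mem_colon_singleton, Submodule.mem_bot, ← Submodule.Quotient.mk_smul,
      hmem] at this
    exact this
  have hune : ¬ ∃ w, y • w = u := by
    intro h
    rw [← hmem] at h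
    apply hpr.ne_top
    rw [hu, h]
    simp
  obtain ⟨u', hu'⟩ := hmu c hc
  obtain ⟨v, hv⟩ := hmu e he
  have heu : e • u' = c • v := hyN (by
    change y • e • u' = y • c • v
    rw [smul_comm y e, hu', smul_comm y c, hv, smul_comm])
  have h0 : (Submodule.Quotient.mk u' : QuotSMulTop c N) = 0 := by
    apply hce.right_eq_zero_of_smul
    rw [← Submodule.Quotient.mk_smul, hmem]
    exact ⟨v, heu.symm⟩
  obtain ⟨w, hw⟩ := (hmem N c u').1 h0
  refine hune ⟨w, hcN ?_⟩
  change c • y • w = c • u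
  rw [← hu', ← hw, smul_comm]

/-- In a Noetherian local ring, a weakly regular sequence in the maximal ideal that is shorter than
another one can be prolonged. -/
theorem RingTheory.Sequence.IsWeaklyRegular.exists_append {R : Type*} [CommRing R]
    [IsLocalRing R] [IsNoetherianRing R] {M : Type*} [AddCommGroup M] [Module R M]
    [Module.Finite R M] {xs ys : List R} (hxm : ∀ x ∈ xs, x ∈ maximalIdeal R)
    (hym : ∀ y ∈ ys, y ∈ maximalIdeal R) (hx : IsWeaklyRegular M xs) (hy : IsWeaklyRegular M ys)
    (hlt : ys.length < xs.length) :
    ∃ c ∈ maximalIdeal R, IsWeaklyRegular M (ys ++ [c]) := by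
  obtain ⟨s, hs⟩ : ∃ s, ys.length = s := ⟨_, rfl⟩
  induction s generalizing M xs ys with
  | zero =>
    obtain rfl := List.length_eq_zero_iff.1 hs
    obtain ⟨x, xs, rfl⟩ := List.exists_cons_of_length_pos hlt
    refine ⟨x, hxm x (by simp), ?_⟩
    rw [List.nil_append, isWeaklyRegular_singleton_iff]
    exact ((isWeaklyRegular_cons_iff _ _ _).1 hx).1
  | succ s ih =>
    obtain rfl | ⟨xs, x, rfl⟩ := xs.eq_nil_or_concat'
    · simp at hlt
    obtain rfl | ⟨ys, y, rfl⟩ := ys.eq_nil_or_concat'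
    · simp at hs
    simp only [List.length_append, List.length_singleton, Nat.add_right_cancel_iff,
      Nat.add_lt_add_iff_right] at hs hlt
    simp only [List.mem_append, List.mem_singleton, or_imp, forall_and, forall_eq] at hxm hym
    rw [isWeaklyRegular_append_iff, isWeaklyRegular_singleton_iff] at hx hy
    -- A single `c` that prolongs both truncated sequences can be moved to the front of each, which
    -- permits induction on `M / cM`.
    obtain ⟨c, hc, hcx, hcy⟩ :=
      exists_isSMulRegular_and (maximalIdeal R) hxm.2 hym.2 hx.2 hy.2
    have key (zs : List R) (hz : ∀ z ∈ zs, z ∈ maximalIdeal R) (h : IsWeaklyRegular M zs)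
        (hcz : IsSMulRegular (M ⧸ Ideal.ofList zs • (⊤ : Submodule R M)) c) :
        IsWeaklyRegular M (c :: zs) := by
      refine IsLocalRing.isWeaklyRegular_of_perm_of_subset_maximalIdeal (rs := zs ++ [c])
        ?_ (List.perm_append_singleton c zs) (by simpa [or_imp, forall_and] using ⟨hz, hc⟩)
      rw [isWeaklyRegular_append_iff, isWeaklyRegular_singleton_iff]
      exact ⟨h, hcz⟩
    have hx' := (isWeaklyRegular_cons_iff _ _ _).1 (key xs hxm.1 hx.1 hcx)
    have hy' := (isWeaklyRegular_cons_iff _ _ _).1 (key ys hym.1 hy.1 hcy)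
    obtain ⟨e, he, hce⟩ := ih hxm.1 hym.1 hx'.2 hy'.2 (by omega) hs
    have hce' : IsWeaklyRegular M (ys ++ [c, e]) := by
      refine IsLocalRing.isWeaklyRegular_of_perm_of_subset_maximalIdeal (rs := c :: (ys ++ [e]))
        ((isWeaklyRegular_cons_iff _ _ _).2 ⟨hy'.1, hce⟩) ?_ ?_
      · exact List.perm_middle.symm
      · simpa [or_imp, forall_and] using ⟨hc, hym.1, he⟩
    rw [isWeaklyRegular_append_iff, isWeaklyRegular_cons_iff, isWeaklyRegular_singleton_iff]
      at hce'
    -- On `M / (ys) M` the sequence `c, e` is regular; exchange `c` for `y`.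
    obtain ⟨z, hz, hyz⟩ :=
      exists_isSMulRegular_quotSMulTop hc he hce'.2.1 hy.2 hce'.2.2
    refine ⟨z, hz, ?_⟩
    rw [List.append_assoc, isWeaklyRegular_append_iff, List.singleton_append,
      isWeaklyRegular_cons_iff, isWeaklyRegular_singleton_iff]
    exact ⟨hy.1, hy.2, hyz⟩

/-- Membership in an ideal generated by variables is read off the support, and multiplication by
another variable only shifts the support. -/
theorem MvPolynomial.isWeaklyRegular_map_X {k σ : Type*} [Field k] (l : List σ) (hl : l.Nodup) :
    IsWeaklyRegular (MvPolynomial σ k) (l.map (MvPolynomial.X (R := k))) := by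
  induction l using List.reverseRecOn with
  | nil => exact IsWeaklyRegular.nil _ _
  | append_singleton l a ih =>
    rw [List.nodup_append] at hl
    rw [List.map_append, isWeaklyRegular_append_iff, List.map_singleton,
      isWeaklyRegular_singleton_iff]
    refine ⟨ih hl.1, ?_⟩
    have hI : Ideal.ofList (l.map (MvPolynomial.X (R := k))) • (⊤ : Submodule (MvPolynomial σ k) _) =
        Ideal.span (MvPolynomial.X '' {i | i ∈ l}) := by
      rw [smul_eq_mul, Ideal.mul_top, Ideal.ofList]
      congr 1
      ext; simp
    rw [isSMulRegular_quotient_iff_mem_of_smul_mem]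
    intro p hp
    rw [hI, MvPolynomial.mem_ideal_span_X_image] at hp ⊢
    intro m hm
    obtain ⟨i, hi, hmi⟩ := hp (m + Finsupp.single a 1) (by
      rw [smul_eq_mul, mul_comm, MvPolynomial.mem_support_iff, MvPolynomial.coeff_mul_X]
      exact MvPolynomial.mem_support_iff.1 hm)
    refine ⟨i, hi, ?_⟩
    have hai : a ≠ i := by
      rintro rfl
      exact hl.2.2 a hi a (by simp) rfl
    simpa [Finsupp.single_apply, hai] using hmi

/-! ### General linear combinations at the origin of affine space. -/

namespace Dist

variable {k : Type*} [Field k] {n : ℕ}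

/-- The form `w_0 F_0 + ⋯ + w_n F_n`. -/
noncomputable def combination {σ A : Type*} [Fintype σ] [CommRing A] [Algebra k A] (F : σ → A) :
    (σ → k) →ₗ[k] A :=
  Fintype.linearCombination k F

theorem combination_apply {σ A : Type*} [Fintype σ] [CommRing A] [Algebra k A] (F : σ → A)
    (w : σ → k) : combination F w = ∑ j, w j • F j := rfl

/-- The ideal of the polynomials without constant term. -/
noncomputable abbrev originIdeal (k σ : Type*) [Field k] : Ideal (MvPolynomial σ k) :=
  RingHom.ker (MvPolynomial.constantCoeff : MvPolynomial σ k →+* k)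

instance (σ : Type*) : (originIdeal k σ).IsMaximal :=
  RingHom.ker_isMaximal_of_surjective _ fun c => ⟨MvPolynomial.C c, by simp⟩

theorem originIdeal_le {σ : Type*} {I : Ideal (MvPolynomial σ k)}
    (h : ∀ i, MvPolynomial.X i ∈ I) : originIdeal k σ ≤ I := by
  intro p hp
  have : p ∈ Ideal.span (MvPolynomial.X '' (Set.univ : Set σ)) := by
    rw [MvPolynomial.mem_ideal_span_X_image]
    intro m hm
    by_contra! H
    have : m = 0 := by ext i; simpa using H i
    subst this
    exact (MvPolynomial.mem_support_iff.1 hm) hp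
  refine Ideal.span_le.2 ?_ this
  rintro _ ⟨i, -, rfl⟩
  exact h i

/-- The local ring of affine space at the origin. -/
noncomputable abbrev OriginLocal (k σ : Type*) [Field k] : Type _ := Localization.AtPrime (originIdeal k σ)

theorem isWeaklyRegular_X_originLocal (n : ℕ) :
    IsWeaklyRegular (OriginLocal k (Fin n)) ((List.finRange n).map fun i =>
      algebraMap (MvPolynomial (Fin n) k) (OriginLocal k (Fin n)) (MvPolynomial.X i)) := by
  have := (MvPolynomial.isWeaklyRegular_map_X (k := k) _ (List.nodup_finRange n)).of_flat
    (S := OriginLocal k (Fin n))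
  rwa [List.map_map] at this

theorem algebraMap_mem_maximalIdeal {σ : Type*} {p : MvPolynomial σ k} :
    algebraMap _ (OriginLocal k σ) p ∈ maximalIdeal (OriginLocal k σ) ↔ p ∈ originIdeal k σ :=
  IsLocalization.AtPrime.to_map_mem_maximal_iff _ _ _

/-- A general linear combination of the `F_j` prolongs a weakly regular sequence. -/
theorem exists_append_combination [Infinite k] {ℓ : MvPolynomial (Fin (n + 1)) k}
    {F : Fin (n + 1) → MvPolynomial (Fin (n + 1)) k}
    (hrad : originIdeal k (Fin (n + 1)) ≤ (Ideal.span (insert ℓ (Set.range F))).radical)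
    (W : Submodule k (Fin (n + 1) → k)) (hW : W ≠ ⊤)
    {ys : List (OriginLocal k (Fin (n + 1)))} (hℓy : algebraMap _ _ ℓ ∈ ys)
    (hym : ∀ y ∈ ys, y ∈ maximalIdeal _)
    (hy : IsWeaklyRegular (OriginLocal k (Fin (n + 1))) ys) (hlen : ys.length < n + 1) :
    ∃ v ∉ W, IsWeaklyRegular (OriginLocal k (Fin (n + 1)))
      (ys ++ [algebraMap _ _ (combination F v)]) := by
  let R := OriginLocal k (Fin (n + 1))
  let N := R ⧸ Ideal.ofList ys • (⊤ : Ideal R)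
  -- Comparison with the regular sequence of the `n + 1` variables: the maximal ideal is not
  -- associated to the quotient `N`.
  obtain ⟨c, hc, hyc⟩ := (isWeaklyRegular_X_originLocal (k := k) (n + 1)).exists_append
    (by
      simp only [List.mem_map, forall_exists_index, and_imp]
      rintro _ i - rfl
      exact algebraMap_mem_maximalIdeal.2 (MvPolynomial.constantCoeff_X _ i)) hym hy (by simpa using hlen)
  rw [isWeaklyRegular_append_iff, isWeaklyRegular_singleton_iff] at hyc
  have hfin := (associatedPrimes.finite R N).to_subtype
  let Ψ : (Fin (n + 1) → k) →ₗ[k] R :=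
    (Algebra.linearMap (MvPolynomial (Fin (n + 1)) k) R).restrictScalars k ∘ₗ combination F
  let V : Option (associatedPrimes R N) → Submodule k (Fin (n + 1) → k) := fun p =>
    p.elim W fun p => (p.1.restrictScalars k).comap Ψ
  -- Over an infinite field finitely many proper subspaces do not cover. If all combinations fell
  -- into an associated prime `p`, then `p` would contain `ℓ` and every `F_j`, hence the maximal
  -- ideal and so `c`.
  obtain ⟨v, hv⟩ := Submodule.exists_forall_notMem_of_forall_ne_top V (by
    rintro (_ | ⟨p, hp⟩)
    · exact hW
    intro htop
    have hpr : p.IsPrime := hp.isPrime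
    obtain ⟨-, u, hu⟩ := Submodule.isAssociatedPrime_iff.1 hp
    have hcp : c ∉ p := fun h => by
      have := Set.mem_biUnion (t := fun p : Ideal R => (p : Set R)) hp h
      rw [biUnion_associatedPrimes_eq_compl_regular] at this
      exact this hyc.2
    apply hcp
    have hle : originIdeal k (Fin (n + 1)) ≤ p.comap (algebraMap _ R) := by
      refine hrad.trans ((Ideal.IsPrime.radical_le_iff inferInstance).2 (Ideal.span_le.2 ?_))
      rintro _ (rfl | ⟨j, rfl⟩)
      · change algebraMap _ _ _ ∈ p
        rw [hu, Submodule.mem_colon_singleton, Submodule.mem_bot]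
        obtain ⟨u, rfl⟩ := Submodule.Quotient.mk_surjective _ u
        rw [← Submodule.Quotient.mk_smul, Submodule.Quotient.mk_eq_zero]
        exact Submodule.smul_mem_smul (Ideal.subset_span hℓy) trivial
      · have : Pi.single j (1 : k) ∈ V (some ⟨p, hp⟩) := htop ▸ trivial
        simpa [V, Ψ, combination] using this
    have : maximalIdeal R ≤ p := by
      rw [← Localization.AtPrime.map_eq_maximalIdeal]
      exact Ideal.map_le_iff_le_comap.2 hle
    exact this hc)
  refine ⟨v, hv none, ?_⟩
  rw [isWeaklyRegular_append_iff, isWeaklyRegular_singleton_iff]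
  refine ⟨hy, ?_⟩
  by_contra hreg
  have hmem : algebraMap _ R (combination F v) ∈ ⋃ p ∈ associatedPrimes R N, (p : Set R) := by
    rw [biUnion_associatedPrimes_eq_compl_regular]
    exact hreg
  simp only [Set.mem_iUnion] at hmem
  obtain ⟨p, hp, hmem⟩ := hmem
  exact hv (some ⟨p, hp⟩) hmem

end Dist

/-! ### Forms with `∑ x_j F_j = 0` and the saturation of their ideal. -/

namespace Dist

variable {k : Type*} [Field k] {n : ℕ}

theorem combination_mem_originIdeal {F : Fin (n + 1) → MvPolynomial (Fin (n + 1)) k}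
    (hF : ∀ j, F j ∈ originIdeal k (Fin (n + 1))) (v : Fin (n + 1) → k) :
    combination F v ∈ originIdeal k (Fin (n + 1)) := by
  rw [combination_apply]
  exact Submodule.sum_mem _ fun j _ => by
    rw [MvPolynomial.smul_eq_C_mul]; exact Ideal.mul_mem_left _ _ (hF j)

/-- General linear combinations of the `F_j` form a regular sequence. -/
theorem exists_isWeaklyRegular_combination [Infinite k] {ℓ : MvPolynomial (Fin (n + 1)) k}
    {F : Fin (n + 1) → MvPolynomial (Fin (n + 1)) k} (hℓ0 : ℓ ≠ 0)
    (hℓ : ℓ ∈ originIdeal k (Fin (n + 1))) (hF : ∀ j, F j ∈ originIdeal k (Fin (n + 1)))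
    (hrad : originIdeal k (Fin (n + 1)) ≤ (Ideal.span (insert ℓ (Set.range F))).radical)
    {u : Fin (n + 1) → k} (hu : u ≠ 0) (s : ℕ) (hs : s ≤ n) :
    ∃ v : Fin s → Fin (n + 1) → k,
      LinearIndependent k (Fin.snoc (α := fun _ => Fin (n + 1) → k) v u) ∧
      IsWeaklyRegular (OriginLocal k (Fin (n + 1)))
        (algebraMap _ (OriginLocal k (Fin (n + 1))) ℓ ::
          List.ofFn fun i => algebraMap _ _ (combination F (v i))) := by
  induction s with
  | zero =>
    refine ⟨Fin.elim0, ?_, ?_⟩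
    · have : Unique (Fin (0 + 1)) := inferInstanceAs (Unique (Fin 1))
      rw [linearIndependent_unique_iff]
      simpa [Fin.snoc] using hu
    · rw [List.ofFn_zero, isWeaklyRegular_singleton_iff]
      have : algebraMap _ (OriginLocal k (Fin (n + 1))) ℓ ≠ 0 := by
        rwa [Ne, IsLocalization.to_map_eq_zero_iff _
          (Ideal.primeCompl_le_nonZeroDivisors (originIdeal k (Fin (n + 1))))]
      exact IsSMulRegular.of_ne_zero this
  | succ s ih =>
    obtain ⟨v, hv, hreg⟩ := ih (by omega)
    have hm : ∀ y ∈ (algebraMap _ (OriginLocal k (Fin (n + 1))) ℓ ::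
        List.ofFn fun i => algebraMap _ _ (combination F (v i))), y ∈ maximalIdeal _ := by
      intro y hy
      rw [List.mem_cons, List.mem_ofFn] at hy
      rcases hy with rfl | ⟨i, rfl⟩
      · exact algebraMap_mem_maximalIdeal.2 hℓ
      · exact algebraMap_mem_maximalIdeal.2 (combination_mem_originIdeal hF _)
    obtain ⟨w, hw, hwreg⟩ := exists_append_combination hrad
      (Submodule.span k (Set.range (Fin.snoc (α := fun _ => Fin (n + 1) → k) v u)))
      -- The `s + 1 ≤ n` vectors found so far do not span, so the new one can be taken independent
      -- of them.
      (fun htop => by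
        have := finrank_span_eq_card hv
        rw [htop, finrank_top, Module.finrank_fin_fun, Fintype.card_fin] at this
        omega)
      (List.mem_cons_self ..) hm hreg (by simp; omega)
    refine ⟨Fin.cons w v, ?_, ?_⟩
    · have := linearIndependent_finCons.2 ⟨hv, hw⟩
      rwa [Fin.cons_snoc_eq_snoc_cons] at this
    · refine IsLocalRing.isWeaklyRegular_of_perm_of_subset_maximalIdeal hwreg ?_ ?_
      · rw [List.cons_append, List.perm_cons, List.ofFn_succ]
        simp
      · intro y hy
        rw [List.mem_append, List.mem_singleton] at hy
        rcases hy with hy | rfl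
        · exact hm y hy
        · exact algebraMap_mem_maximalIdeal.2 (combination_mem_originIdeal hF _)

theorem coeff_zero_mul_of_isHomogeneous {σ : Type*} {D : ℕ} {p H : MvPolynomial σ k}
    (hH : H.IsHomogeneous D) :
    MvPolynomial.homogeneousComponent D (p * H) = MvPolynomial.C (MvPolynomial.constantCoeff p) * H := by
  let _ : GradedAlgebra (MvPolynomial.homogeneousSubmodule σ k) := MvPolynomial.gradedAlgebra
  have h (q : MvPolynomial σ k) (i : ℕ) :
      (DirectSum.decompose (MvPolynomial.homogeneousSubmodule σ k) q i : MvPolynomial σ k) =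
        MvPolynomial.homogeneousComponent i q :=
    MvPolynomial.decomposition.decompose'_apply q i
  have := DirectSum.coe_decompose_mul_of_right_mem_of_le
    (MvPolynomial.homogeneousSubmodule σ k) (a := p) (b := H) (i := D) (n := D) hH le_rfl
  rwa [h, h, tsub_self, MvPolynomial.homogeneousComponent_zero] at this

/-- The linear form `ℓ` with `ℓ G` in the ideal. -/
theorem linear_mul_mem_range [Infinite k] {D : ℕ} {ℓ G : MvPolynomial (Fin (n + 1)) k}
    {F : Fin (n + 1) → MvPolynomial (Fin (n + 1)) k} (hℓ0 : ℓ ≠ 0)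
    (hℓ : ℓ ∈ originIdeal k (Fin (n + 1))) (hF : ∀ j, (F j).IsHomogeneous (D + 1))
    (hrad : originIdeal k (Fin (n + 1)) ≤ (Ideal.span (insert ℓ (Set.range F))).radical)
    (hrel : ∑ j, MvPolynomial.X j * F j = 0)
    (hG : G.IsHomogeneous D) {N : ℕ} (hGmem : ℓ ^ N * G ∈ Ideal.span (Set.range F))
    {u : Fin (n + 1) → k} (hu : u ≠ 0) :
    ∃ a : Module.Dual k (Fin (n + 1) → k), a u = 1 ∧
      combination (fun j => MvPolynomial.X (R := k) j) (fun j => a (Pi.single j 1)) * G ∈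
        LinearMap.range (combination (k := k) F) := by
  have hF0 (j) : F j ∈ originIdeal k (Fin (n + 1)) := by
    have := (hF j).coeff_eq_zero (d := 0) (by simp)
    exact this
  obtain ⟨v, hv, hreg⟩ := exists_isWeaklyRegular_combination hℓ0 hℓ hF0 hrad hu n le_rfl
  let b := basisOfLinearIndependentOfCardEqFinrank hv (by simp)
  let a := b.coord (Fin.last n)
  set I : Ideal (MvPolynomial (Fin (n + 1)) k) :=
    Ideal.span (Set.range fun i => combination F (v i))
  have hbu : b (Fin.last n) = u := by simp [b]
  have hbv (i : Fin n) : b i.castSucc = v i := by simp [b]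
  -- Modulo `I` only the `u`-component of `w` survives.
  have hmod (w) : combination F w - a w • combination F u ∈ I := by
    have h : combination F w = combination F (∑ i, b.repr w i • b i) := by rw [b.sum_repr]
    rw [h, Fin.sum_univ_castSucc, hbu, map_add, map_smul, map_sum]
    simp only [hbv, map_smul]
    rw [show b.repr w (Fin.last n) = a w from rfl, add_sub_cancel_right]
    refine Submodule.sum_mem _ fun i _ => ?_
    rw [MvPolynomial.smul_eq_C_mul]
    exact Ideal.mul_mem_left _ _ (Ideal.subset_span ⟨i, rfl⟩)
  set q := combination (fun j => MvPolynomial.X (R := k) j) (fun j => a (Pi.single j 1)) with hq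
  have hqu : q * combination F u ∈ I := by
    -- The relation `∑ x_j F_j = 0`, reduced modulo `I`.
    have : -(∑ j, MvPolynomial.X j * (combination F (Pi.single j (1 : k)) -
        a (Pi.single j 1) • combination F u)) ∈ I :=
      neg_mem (Submodule.sum_mem _ fun j _ => Ideal.mul_mem_left _ _ (hmod _))
    convert this using 1
    have hFj (j) : combination F (Pi.single j (1 : k)) = F j := by simp [combination]
    simp only [hFj, mul_sub, Finset.sum_sub_distrib, hrel, zero_sub, neg_neg]
    rw [hq, combination_apply, Finset.sum_mul]
    simp
  have hqF : Ideal.span (Set.range F) ≤ I.colon {q} := by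
    rw [Ideal.span_le]
    rintro _ ⟨j, rfl⟩
    rw [SetLike.mem_coe, Submodule.mem_colon_singleton]
    have h1 := hmod (Pi.single j (1 : k))
    rw [show combination F (Pi.single j (1 : k)) = F j by simp [combination]] at h1
    have h2 := add_mem (Ideal.mul_mem_left _ q h1)
      (Ideal.mul_mem_left _ (MvPolynomial.C (a (Pi.single j 1))) hqu)
    convert h2 using 1
    rw [MvPolynomial.smul_eq_C_mul, smul_eq_mul]
    ring
  have hqG : ℓ ^ N * (q * G) ∈ I := by
    have := Submodule.mem_colon_singleton.1 (hqF hGmem)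
    rw [smul_eq_mul] at this
    convert this using 1
    ring
  have hloc : algebraMap _ (OriginLocal k (Fin (n + 1))) (q * G) ∈
      I.map (algebraMap _ (OriginLocal k (Fin (n + 1)))) := by
    -- In a local ring `ℓ` may be moved to the end, which makes it regular modulo `I` and lets `ℓ ^
    -- N` be cancelled.
    have hperm : IsWeaklyRegular (OriginLocal k (Fin (n + 1)))
        ((List.ofFn fun i => algebraMap _ _ (combination F (v i))) ++
          [algebraMap _ (OriginLocal k (Fin (n + 1))) ℓ]) := by
      refine IsLocalRing.isWeaklyRegular_of_perm_of_subset_maximalIdeal hreg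
        (List.perm_append_singleton _ _).symm ?_
      intro y hy
      rw [List.mem_cons, List.mem_ofFn] at hy
      rcases hy with rfl | ⟨i, rfl⟩
      · exact algebraMap_mem_maximalIdeal.2 hℓ
      · exact algebraMap_mem_maximalIdeal.2 (combination_mem_originIdeal hF0 _)
    rw [isWeaklyRegular_append_iff, isWeaklyRegular_singleton_iff] at hperm
    have hI : Ideal.ofList (List.ofFn fun i => algebraMap _ (OriginLocal k (Fin (n + 1)))
        (combination F (v i))) • (⊤ : Ideal (OriginLocal k (Fin (n + 1)))) =
        I.map (algebraMap _ (OriginLocal k (Fin (n + 1)))) := by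
      rw [smul_eq_mul, Ideal.mul_top, Ideal.ofList, Ideal.map_span, ← Set.range_comp]
      congr 1
      ext
      simp
    rw [← hI]
    refine mem_of_isSMulRegular_quotient_of_smul_mem (hperm.2.pow N) ?_
    rw [hI, smul_eq_mul, ← map_pow, ← map_mul]
    exact Ideal.mem_map_of_mem _ hqG
  obtain ⟨⟨⟨x, hx⟩, t⟩, ht⟩ :=
    (IsLocalization.mem_map_algebraMap_iff (originIdeal k (Fin (n + 1))).primeCompl _).1 hloc
  replace ht : t.1 * (q * G) ∈ I := by
    rw [← map_mul] at ht
    have := IsLocalization.injective _ (Ideal.primeCompl_le_nonZeroDivisors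
      (originIdeal k (Fin (n + 1)))) ht
    rw [mul_comm, this]
    exact hx
  obtain ⟨c, hc⟩ := (Ideal.mem_span_range_iff_exists_fun).1 ht
  have ht0 : MvPolynomial.constantCoeff t.1 ≠ 0 := t.2
  have hqhom : (q * G).IsHomogeneous (D + 1) := by
    refine add_comm 1 D ▸ MvPolynomial.IsHomogeneous.mul ?_ hG
    rw [hq, combination_apply]
    refine MvPolynomial.IsHomogeneous.sum _ _ _ fun j _ => ?_
    rw [MvPolynomial.smul_eq_C_mul]
    exact (MvPolynomial.isHomogeneous_X k j).C_mul _
  have hcomb (w : Fin (n + 1) → k) : (combination F w).IsHomogeneous (D + 1) := by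
    rw [combination_apply]
    refine MvPolynomial.IsHomogeneous.sum _ _ _ fun j _ => ?_
    rw [MvPolynomial.smul_eq_C_mul]
    exact (hF j).C_mul _
  -- `q G` and the generators all have degree `D + 1`: in this degree only the constant terms of `t`
  -- and of the coefficients `c i` remain.
  have hcomp := congrArg (MvPolynomial.homogeneousComponent (D + 1)) hc
  rw [map_sum, coeff_zero_mul_of_isHomogeneous hqhom] at hcomp
  simp only [coeff_zero_mul_of_isHomogeneous (hcomb _)] at hcomp
  refine ⟨a, by rw [← hbu]; simp [a],
    (MvPolynomial.constantCoeff t.1)⁻¹ • ∑ i, MvPolynomial.constantCoeff (c i) • v i, ?_⟩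
  rw [map_smul, map_sum]
  simp only [map_smul]
  simp only [← MvPolynomial.smul_eq_C_mul] at hcomp
  rw [hcomp, smul_smul, inv_mul_cancel₀ ht0, one_smul]

/-- If `x_0 F_0 + ⋯ + x_n F_n = 0`, where the `F_j` are forms of degree `D + 1 ≥ 2` without common factor
and with finitely many zeros, no form `G ≠ 0` of degree `D` is in the saturation of their ideal. -/
theorem eq_zero_of_pow_mul_mem_span [Infinite k] {D : ℕ} (hD : 1 ≤ D)
    {ℓ G : MvPolynomial (Fin (n + 1)) k}
    {F : Fin (n + 1) → MvPolynomial (Fin (n + 1)) k} (hℓ0 : ℓ ≠ 0)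
    (hℓ : ℓ ∈ originIdeal k (Fin (n + 1))) (hF : ∀ j, (F j).IsHomogeneous (D + 1))
    (hrad : originIdeal k (Fin (n + 1)) ≤ (Ideal.span (insert ℓ (Set.range F))).radical)
    (hrel : ∑ j, MvPolynomial.X j * F j = 0)
    (hunit : ∀ g, (∀ j, g ∣ F j) → IsUnit g)
    (hG : G.IsHomogeneous D)
    (hGmem : ∀ j, ∃ N : ℕ, MvPolynomial.X j ^ N * G ∈ Ideal.span (Set.range F)) : G = 0 := by
  by_contra hG0
  obtain ⟨N, hN⟩ : ∃ N : ℕ, ℓ ^ N * G ∈ Ideal.span (Set.range F) := by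
    have : originIdeal k (Fin (n + 1)) ≤ ((Ideal.span (Set.range F)).colon {G}).radical :=
      originIdeal_le fun j => by
        obtain ⟨N, hN⟩ := hGmem j
        exact ⟨N, Submodule.mem_colon_singleton.2 hN⟩
    obtain ⟨N, hN⟩ := this hℓ
    exact ⟨N, Submodule.mem_colon_singleton.1 hN⟩
  let Λ : (Fin (n + 1) → k) →ₗ[k] MvPolynomial (Fin (n + 1)) k :=
    LinearMap.mulRight k G ∘ₗ combination (fun j => MvPolynomial.X (R := k) j)
  have hΛ : LinearMap.range Λ ≤ LinearMap.range (combination (k := k) F) := by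
    rw [LinearMap.range_le_iff_comap]
    by_contra htop
    -- A proper subspace lies in a hyperplane `f = 0`. With the coefficients of `f` as `u`, the
    -- resulting `a` lies in the subspace, yet `f(a) = a(u) = 1`.
    obtain ⟨f, hf0, hf⟩ := Submodule.exists_le_ker_of_lt_top _ (lt_top_iff_ne_top.2 htop)
    obtain ⟨a, hau, ha⟩ := linear_mul_mem_range hℓ0 hℓ hF hrad hrel hG hN
      (u := fun j => f (Pi.single j 1)) (fun h => hf0 (by
        ext j
        simpa using congrFun h j))
    have := hf (x := fun j => a (Pi.single j 1)) ha
    rw [LinearMap.mem_ker] at this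
    rw [LinearMap.pi_apply_eq_sum_univ a] at hau
    rw [LinearMap.pi_apply_eq_sum_univ f] at this
    have h1 (i : Fin (n + 1)) : (fun j => if i = j then (1 : k) else 0) = Pi.single i 1 := by
      ext j; simp [Pi.single_apply, eq_comm]
    simp only [h1, smul_eq_mul] at this hau
    simp only [mul_comm] at this hau
    rw [this] at hau
    exact zero_ne_one hau
  have hΛinj : Function.Injective Λ := by
    rw [injective_iff_map_eq_zero]
    intro w hw
    have hw' : combination (fun j => MvPolynomial.X (R := k) j) w * G = 0 := hw
    have h0 := (mul_eq_zero.1 hw').resolve_right hG0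
    ext j
    have := congrArg (MvPolynomial.coeff (Finsupp.single j 1)) h0
    rw [combination_apply, MvPolynomial.coeff_sum] at this
    simpa [MvPolynomial.coeff_X, Finsupp.single_left_inj] using this
  -- The left side has dimension `n + 1`, the right side at most that.
  have heq : LinearMap.range Λ = LinearMap.range (combination (k := k) F) := by
    refine Submodule.eq_of_le_of_finrank_le hΛ ?_
    rw [LinearMap.finrank_range_of_inj hΛinj]
    exact LinearMap.finrank_range_le _
  have hGu : IsUnit G := by
    refine hunit G fun j => ?_
    have : F j ∈ LinearMap.range Λ := by
      rw [heq]
      exact ⟨Pi.single j 1, by simp [combination]⟩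
    obtain ⟨w, hw⟩ := this
    exact ⟨_, hw.symm.trans (mul_comm _ _)⟩
  have := hG.totalDegree hG0
  obtain ⟨c, -, rfl⟩ := MvPolynomial.isUnit_iff_eq_C_of_isReduced.1 hGu
  rw [MvPolynomial.totalDegree_C] at this
  omega

end Dist

/-! ### The singular ideal of the kernel of a `1`-form. -/

namespace Dist

/-- If `f_1 w_1 + ⋯ + f_{m+1} w_{m+1} = 0`, then the maximal minors of `w` are proportional to `f`. -/
theorem exists_smul_eq_smul_of_sum_smul_eq_zero {A N D ι : Type*} [CommRing A] [AddCommGroup N]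
    [Module A N] [AddCommGroup D] [Module A D] [Fintype ι] [DecidableEq ι] {m : ℕ}
    (hcard : Fintype.card ι = m + 1) (Ψ : N [⋀^Fin m]→ₗ[A] D) {f : ι → A} {w : ι → N}
    (hfw : ∑ l, f l • w l = 0) (g : Fin m → ι) :
    ∃ j, ∀ i, ∃ c, f i • Ψ (w ∘ g) = f j • c := by
  by_cases hg : Function.Injective g
  · obtain ⟨j, hj⟩ : ∃ j, j ∉ Set.range g := by
      by_contra! H
      have := Fintype.card_le_of_surjective g H
      simp at this
      omega
    refine ⟨j, fun i => ?_⟩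
    by_cases hij : i = j
    · exact ⟨Ψ (w ∘ g), by rw [hij]⟩
    have hi : i ∈ Set.range g := by
      by_contra hi
      have hcard' := Finset.card_le_univ (insert i (insert j (Finset.univ.image g)))
      rw [Finset.card_insert_of_notMem, Finset.card_insert_of_notMem,
        Finset.card_image_of_injective _ hg, hcard, Finset.card_univ, Fintype.card_fin] at hcard'
      · omega
      · simpa using hj
      · simpa [hij] using hi
    obtain ⟨a, rfl⟩ := hi
    refine ⟨-Ψ (Function.update (w ∘ g) a (w j)), ?_⟩
    -- The relation is put in slot `a`. All terms with a repeated argument vanish, leaving `l = g a`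
    -- and the omitted index `j`.
    have h0 : ∑ l, f l • Ψ (Function.update (w ∘ g) a (w l)) = 0 := by
      simp_rw [← AlternatingMap.map_update_smul]
      rw [← AlternatingMap.map_update_sum, hfw, AlternatingMap.map_update_zero]
    rw [← Finset.add_sum_erase _ _ (Finset.mem_univ (g a)),
      ← Finset.add_sum_erase _ _ (Finset.mem_erase.2 ⟨Ne.symm hij, Finset.mem_univ j⟩),
      Finset.sum_eq_zero, add_zero] at h0
    · rw [smul_neg, ← eq_neg_of_add_eq_zero_left h0]
      congr 2
      exact (Function.update_eq_self a (w ∘ g)).symm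
    · intro l hl
      simp only [Finset.mem_erase, Finset.mem_univ, and_true] at hl
      have hl' : l ∈ Set.range g := by
        by_contra hl'
        have hcard' := Finset.card_le_univ (insert l (insert j (Finset.univ.image g)))
        rw [Finset.card_insert_of_notMem, Finset.card_insert_of_notMem,
          Finset.card_image_of_injective _ hg, hcard, Finset.card_univ, Fintype.card_fin] at hcard'
        · omega
        · simpa using hj
        · simpa [hl.1] using hl'
      obtain ⟨b, rfl⟩ := hl'
      have hab : a ≠ b := fun h => hl.2 (by rw [h])
      rw [Ψ.map_eq_zero_of_eq (i := a) (j := b) _ (by simp [hab.symm]) hab, smul_zero]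
  · have : Nonempty ι := Fintype.card_pos_iff.1 (by omega)
    simp only [Function.Injective, not_forall] at hg
    obtain ⟨a, b, hab, hne⟩ := hg
    refine ⟨Classical.arbitrary ι, fun i => ⟨0, ?_⟩⟩
    rw [Ψ.map_eq_zero_of_eq (i := a) (j := b) _ (by simp [hab]) hne, smul_zero, smul_zero]

theorem _root_.KaehlerDifferential.span_range_D_of_adjoin_eq_top {R A ι : Type*} [CommRing R]
    [CommRing A] [Algebra R A] {y : ι → A} (hy : Algebra.adjoin R (Set.range y) = ⊤) :
    Submodule.span A (Set.range fun i => KaehlerDifferential.D R A (y i)) = ⊤ := by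
  rw [← top_le_iff, ← KaehlerDifferential.span_range_derivation, Submodule.span_le]
  rintro _ ⟨a, rfl⟩
  have ha : a ∈ Algebra.adjoin R (Set.range y) := hy ▸ trivial
  induction ha using Algebra.adjoin_induction with
  | mem x hx => obtain ⟨i, rfl⟩ := hx; exact Submodule.subset_span ⟨i, rfl⟩
  | algebraMap r => simp
  | add a b _ _ ha hb => rw [map_add]; exact add_mem ha hb
  | mul a b _ _ ha hb =>
    rw [Derivation.leibniz]
    exact add_mem (Submodule.smul_mem _ _ hb) (Submodule.smul_mem _ _ ha)

/-- The singular ideal of the kernel of a `1`-form is contained in the ideal generated by the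
coefficients of the form. -/
theorem singularIdeal_le {k A : Type u} [Field k] [CommRing A] [IsDomain A] [Algebra k A]
    {ι : Type*} [Fintype ι] {m : ℕ} (hcard : Fintype.card ι = m + 1) {y : ι → A}
    (hy : Algebra.adjoin k (Set.range y) = ⊤) {f : ι → A}
    (hf : ∀ j c, (∀ i, f j ∣ f i * c) → f j ∣ c) {T : Submodule A (Derivation k A A)}
    (hT : ∀ v ∈ T, ∑ j, f j * v (y j) = 0) :
    singularIdeal T m ≤ Ideal.span (Set.range f) := by
  classical
  set w : ι → Module.Dual A T := fun j => dualMap T (KaehlerDifferential.D k A (y j)) with hw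
  have hwv (j) (v : T) : w j v = v.1 (y j) := by
    exact v.1.liftKaehlerDifferential_comp_D (y j)
  have hfw : ∑ l, f l • w l = 0 := by
    ext v
    simpa [hwv] using hT v.1 v.2
  let Ψ : Module.Dual A T [⋀^Fin m]→ₗ[A] Module.Dual A (⋀[A]^m T) :=
    (exteriorPower.pairingDual A T m).compAlternatingMap (exteriorPower.ιMulti A m)
  have key (g : Fin m → ι) (δ : Module.Dual A (Module.Dual A (⋀[A]^m T))) :
      δ (Ψ (w ∘ g)) ∈ Ideal.span (Set.range f) := by
    obtain ⟨j, hj⟩ := exists_smul_eq_smul_of_sum_smul_eq_zero hcard Ψ hfw g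
    -- By proportionality `f j` divides every `f i * Ψ (w ∘ g) t`, so `hf` applies.
    have hdvd (t) : f j ∣ Ψ (w ∘ g) t := by
      refine hf j _ fun i => ?_
      obtain ⟨c, hc⟩ := hj i
      exact ⟨c t, LinearMap.congr_fun hc t⟩
    by_cases h0 : f j = 0
    · have : Ψ (w ∘ g) = 0 := by
        refine LinearMap.ext fun t => ?_
        have := hdvd t
        rwa [h0, zero_dvd_iff] at this
      rw [this, map_zero]
      exact zero_mem _
    choose h hh using hdvd
    -- The division takes place in the dual module: `δ` is only defined on functionals, so the
    -- quotient by `f j` has to be linear.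
    let H : Module.Dual A (⋀[A]^m T) :=
      { toFun := h
        map_add' := fun s t => mul_left_cancel₀ h0 (by
          rw [mul_add, ← hh, ← hh, ← hh, map_add])
        map_smul' := fun a t => mul_left_cancel₀ h0 (by
          rw [← hh, map_smul, hh, smul_eq_mul, RingHom.id_apply, smul_eq_mul]; ring) }
    have : Ψ (w ∘ g) = f j • H := LinearMap.ext hh
    rw [this, map_smul, smul_eq_mul]
    exact Ideal.mul_mem_right _ _ (Ideal.subset_span ⟨j, rfl⟩)
  rintro _ ⟨x, rfl⟩
  induction x using TensorProduct.induction_on with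
  | zero => rw [map_zero]; exact zero_mem _
  | add a b ha hb => rw [map_add]; exact add_mem ha hb
  | tmul α δ =>
    have hα : α ∈ Submodule.span A (exteriorPower.ιMulti A m '' {a | Set.range a ⊆
        Set.range fun i => KaehlerDifferential.D k A (y i)}) := by
      rw [exteriorPower.ιMulti_span_of_span A m _
        (KaehlerDifferential.span_range_D_of_adjoin_eq_top hy)]
      trivial
    rw [TensorProduct.lift.tmul, LinearMap.comp_apply, Module.Dual.eval_apply]
    induction hα using Submodule.span_induction with
    | zero => rw [map_zero, map_zero]; exact zero_mem _
    | add a b _ _ ha hb => rw [map_add, map_add]; exact add_mem ha hb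
    | smul a b _ hb => rw [map_smul, map_smul]; exact Ideal.mul_mem_left _ _ hb
    | mem α hα =>
      obtain ⟨a, ha, rfl⟩ := hα
      choose g hg using fun i => ha ⟨i, rfl⟩
      convert key g δ using 1
      congr 1
      rw [formMap, LinearMap.comp_apply, exteriorPower.map_apply_ιMulti]
      change _ = exteriorPower.pairingDual A T m (exteriorPower.ιMulti A m _)
      congr 2
      funext i
      rw [Function.comp_apply, ← hg i]
      rfl

end Dist

/-! ### Values of functions on the charts. -/

namespace Dist

section ProjectiveSpace

variable {k : Type u} [Field k] {n : ℕ}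

/-- The homogeneous prime ideal of a point. -/
noncomputable def pointIdeal (p : projectiveSpace k n) : Ideal (MvPolynomial (Fin (n + 1)) k) :=
  ProjectiveSpectrum.asHomogeneousIdeal (𝒜 := forms k n) p |>.toIdeal

instance (p : projectiveSpace k n) : (pointIdeal p).IsPrime :=
  ProjectiveSpectrum.isPrime (𝒜 := forms k n) p

/-- The localization of the homogeneous coordinate ring at the prime ideal of a point. -/
abbrev PointLocal (p : projectiveSpace k n) : Type u :=
  Localization.AtPrime (pointIdeal p)

/-- The value of a germ of functions at a point. -/
noncomputable def stalkEval (p : projectiveSpace k n) :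
    (projectiveSpace k n).presheaf.stalk p →+* PointLocal p :=
  (algebraMap (HomogeneousLocalization.AtPrime (forms k n) (pointIdeal p)) (PointLocal p)).comp
    (Proj.stalkIso (forms k n) p).hom.hom

/-- The value of a function at a point. -/
noncomputable def evalAt {U : (projectiveSpace k n).Opens} (p : projectiveSpace k n) (hp : p ∈ U) :
    Γ(projectiveSpace k n, U) →+* PointLocal p :=
  (stalkEval p).comp ((projectiveSpace k n).presheaf.germ U p hp).hom

theorem evalAt_res {U V : (projectiveSpace k n).Opens} (h : V ≤ U) {p : projectiveSpace k n}
    (hp : p ∈ V) (s : Γ(projectiveSpace k n, U)) :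
    evalAt p hp (res h s) = evalAt p (h hp) s :=
  congrArg (stalkEval p) ((projectiveSpace k n).presheaf.germ_res_apply (homOfLE h) p hp s)

theorem isUnit_evalAt {U : (projectiveSpace k n).Opens} {p : projectiveSpace k n} (hp : p ∈ U)
    {s : Γ(projectiveSpace k n, U)} (h : p ∈ (projectiveSpace k n).basicOpen s) :
    IsUnit (evalAt p hp s) :=
  (((projectiveSpace k n).mem_basicOpen s p hp).1 h).map (stalkEval p)

theorem evalAt_awayToSection (i : Fin (n + 1)) {p : projectiveSpace k n}
    (hp : p ∈ (chart k i).1) (x : HomogeneousLocalization.Away (forms k n) (coord i)) :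
    evalAt p hp (Proj.awayToSection (forms k n) (coord i) x) =
      (HomogeneousLocalization.mapId (forms k n)
        (Q := (pointIdeal p).primeCompl) (Submonoid.powers_le.mpr hp) x).val := by
  have h := congrArg (fun φ => φ.hom x)
    (ProjectiveSpectrum.Proj.awayToSection_germ (forms k n) (coord i) p hp)
  have h2 := congrArg (stalkEval p) h
  refine h2.trans ?_
  change algebraMap (HomogeneousLocalization.AtPrime (forms k n) (pointIdeal p)) (PointLocal p)
    ((Proj.stalkIso' (forms k n) p) ((Proj.stalkIso' (forms k n) p).symm _)) = _
  rw [RingEquiv.apply_symm_apply]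
  rfl

/-- Values are taken in the full localization, not its degree zero part, so that denominators `x_i ^
e` can be cleared. -/
theorem evalAt_dehomogenize {e : ℕ} (F : forms k n e) {i : Fin (n + 1)} {p : projectiveSpace k n}
    (hp : p ∈ (chart k i).1) :
    evalAt p hp (dehomogenize F i) *
        algebraMap (MvPolynomial (Fin (n + 1)) k) (PointLocal p) (coord i) ^ e =
      algebraMap _ (PointLocal p) F.1 := by
  rw [dehomogenize, evalAt_awayToSection, ← map_pow]
  have : (HomogeneousLocalization.mapId (forms k n) (Q := (pointIdeal p).primeCompl)
      (Submonoid.powers_le.mpr hp) (HomogeneousLocalization.Away.mk (forms k n) (coord_mem i) e F.1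
      (by simpa only [smul_eq_mul, mul_one] using F.2))).val =
      Localization.mk F.1 ⟨coord i ^ e, Submonoid.powers_le.mpr hp ⟨e, rfl⟩⟩ := rfl
  rw [this, Localization.mk_eq_mk']
  exact IsLocalization.mk'_spec _ _ _

end ProjectiveSpace
end Dist

/-! ### The `k`-algebra structure on the charts and the generic point. -/

namespace Dist

section ProjectiveSpace

variable {k : Type u} [Field k] {n : ℕ}

theorem ι_toSpecZero (i : Fin (n + 1)) :
    (chart k i).1.ι ≫ Proj.toSpecZero (forms k n) =
      Proj.basicOpenToSpec (forms k n) (coord i) ≫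
        Spec.map (CommRingCat.ofHom (HomogeneousLocalization.fromZeroRingHom (forms k n) _)) := by
  rw [← Proj.awayι_toSpecZero (forms k n) (coord i) (coord_mem i) one_pos, Proj.awayι,
    ← Proj.basicOpenIsoSpec_hom (forms k n) (coord i) (coord_mem i) one_pos, Category.assoc,
    Iso.hom_inv_id_assoc]

theorem _root_.AlgebraicGeometry.Scheme.Hom.appLE_top_eq_comp_topIso_hom {X Y : Scheme.{u}}
    (p : X ⟶ Y) (U : X.Opens) :
    p.appLE ⊤ U le_top = (U.ι ≫ p).appTop ≫ U.topIso.hom := by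
  rw [Scheme.Hom.comp_appTop, Category.assoc]
  change p.appTop ≫ X.presheaf.map _ = _
  congr 1
  rw [Scheme.Opens.ι_appTop, Scheme.Opens.topIso_hom]
  exact (X.presheaf.map_comp _ _).symm ▸ rfl

theorem appLE_projectiveSpaceOver (i : Fin (n + 1)) :
    (Scheme.ΓSpecIso (.of k)).inv ≫ (projectiveSpaceOver k n).appLE ⊤ (chart k i).1 le_top =
      CommRingCat.ofHom (algebraMap k (forms k n 0)) ≫
        CommRingCat.ofHom (HomogeneousLocalization.fromZeroRingHom (forms k n) _) ≫
          Proj.awayToSection (forms k n) (coord i) := by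
  rw [Scheme.Hom.appLE_top_eq_comp_topIso_hom, projectiveSpaceOver, ← Category.assoc (chart k i).1.ι,
    ι_toSpecZero (k := k) i, Category.assoc, ← Spec.map_comp,
    Scheme.Hom.comp_appTop, Category.assoc]
  have h : (Proj.basicOpenToSpec (forms k n) (coord i)).appTop ≫ (chart k i).1.topIso.hom =
      (Scheme.ΓSpecIso _).hom ≫ Proj.awayToSection (forms k n) (coord i) := by
    rw [Scheme.Hom.appTop, Proj.basicOpenToSpec_app_top, Category.assoc, Category.assoc,
      Iso.inv_hom_id, Category.comp_id]
  rw [h, Scheme.ΓSpecIso_naturality_assoc, Iso.inv_hom_id_assoc, Category.assoc]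

theorem evalAt_sectionAlgebra {i : Fin (n + 1)} {p : projectiveSpace k n}
    (hp : p ∈ (chart k i).1) (c : k) :
    evalAt p hp ((sectionAlgebra (projectiveSpaceOver k n) (chart k i).1).algebraMap c) =
      algebraMap (MvPolynomial (Fin (n + 1)) k) (PointLocal p) (MvPolynomial.C c) := by
  have h := congrArg (fun φ => φ.hom c) (appLE_projectiveSpaceOver (k := k) i)
  refine (congrArg (evalAt p hp) h).trans ((evalAt_awayToSection i hp _).trans ?_)
  exact Localization.mk_one_eq_algebraMap _

theorem exists_dehomogenize_eq (i : Fin (n + 1)) (s : Γ(projectiveSpace k n, (chart k i).1)) :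
    ∃ (N : ℕ) (P : forms k n N), dehomogenize P i = s := by
  have hbij : Function.Bijective (Proj.awayToSection (forms k n) (coord i)) :=
    ConcreteCategory.bijective_of_isIso
      (Proj.basicOpenIsoAway (forms k n) (coord i) (coord_mem i) one_pos).hom
  obtain ⟨z, rfl⟩ := hbij.2 s
  obtain ⟨N, P, hP, rfl⟩ := HomogeneousLocalization.Away.mk_surjective (forms k n) (coord_mem i) z
  exact ⟨N, ⟨P, by simpa using hP⟩, rfl⟩

theorem dehomogenize_zero (e : ℕ) (i : Fin (n + 1)) :
    dehomogenize (0 : forms k n e) i = 0 := by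
  have : HomogeneousLocalization.Away.mk (forms k n) (coord_mem i) e (0 : forms k n e).1
      (by simp) = 0 := by
    ext
    rw [HomogeneousLocalization.Away.val_mk]
    simp [Localization.mk_zero]
  rw [dehomogenize, this, map_zero]

variable (k n) in
/-- The generic point of projective space. -/
noncomputable def genericPt : projectiveSpace k n :=
  show ProjectiveSpectrum (forms k n) from
  { asHomogeneousIdeal := ⊥
    isPrime := by
      change (⊥ : Ideal _).IsPrime
      exact Ideal.isPrime_bot
    not_irrelevant_le := fun h => by
      have : (coord 0 : MvPolynomial (Fin (n + 1)) k) ∈ (⊥ : HomogeneousIdeal (forms k n)) :=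
        h (HomogeneousIdeal.mem_irrelevant_of_mem _ one_pos (coord_mem 0))
      exact MvPolynomial.X_ne_zero 0 this }

theorem genericPt_mem_chart (i : Fin (n + 1)) : genericPt k n ∈ (chart k i).1 := fun h =>
  MvPolynomial.X_ne_zero (R := k) i h

end ProjectiveSpace
end Dist

/-! ### Forms on the charts and the ideal of the singular scheme. -/

namespace Dist

section ProjectiveSpace

variable {k : Type u} [Field k] {n : ℕ}

instance (p : projectiveSpace k n) : IsDomain (PointLocal p) :=
  IsLocalization.isDomain_localization (Ideal.primeCompl_le_nonZeroDivisors _)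

theorem algebraMap_pointLocal_injective (p : projectiveSpace k n) :
    Function.Injective (algebraMap (MvPolynomial (Fin (n + 1)) k) (PointLocal p)) :=
  IsLocalization.injective _ (Ideal.primeCompl_le_nonZeroDivisors (pointIdeal p))

theorem algebraMap_coord_ne_zero (p : projectiveSpace k n) (i : Fin (n + 1)) :
    algebraMap (MvPolynomial (Fin (n + 1)) k) (PointLocal p) (coord i) ≠ 0 := by
  rw [Ne, map_eq_zero_iff _ (algebraMap_pointLocal_injective p)]
  exact MvPolynomial.X_ne_zero i

/-- This reduces identities between functions on a chart to identities between polynomials. -/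
theorem evalAt_genericPt_injective (i : Fin (n + 1)) :
    Function.Injective (evalAt (genericPt k n) (genericPt_mem_chart i)) := by
  rw [injective_iff_map_eq_zero]
  intro s hs
  obtain ⟨N, P, rfl⟩ := exists_dehomogenize_eq i s
  have := evalAt_dehomogenize P (genericPt_mem_chart i)
  rw [hs, zero_mul, eq_comm, map_eq_zero_iff _ (algebraMap_pointLocal_injective _)] at this
  obtain rfl : P = 0 := Subtype.ext this
  exact dehomogenize_zero N i

instance (i : Fin (n + 1)) : IsDomain Γ(projectiveSpace k n, (chart k i).1) :=
  (evalAt_genericPt_injective i).isDomain _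

/-- Equality of two functions on a chart, by clearing denominators. -/
theorem eq_of_evalAt_mul_pow {i : Fin (n + 1)} {s t : Γ(projectiveSpace k n, (chart k i).1)}
    (N : ℕ) (h : evalAt (genericPt k n) (genericPt_mem_chart i) s *
        algebraMap (MvPolynomial (Fin (n + 1)) k) (PointLocal (genericPt k n)) (coord i) ^ N =
      evalAt (genericPt k n) (genericPt_mem_chart i) t *
        algebraMap (MvPolynomial (Fin (n + 1)) k) (PointLocal (genericPt k n)) (coord i) ^ N) : s = t :=
  evalAt_genericPt_injective i
    (mul_right_cancel₀ (pow_ne_zero N (algebraMap_coord_ne_zero _ i)) h)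

theorem ratio_self (i : Fin (n + 1)) : ratio (k := k) i i = 1 := by
  refine eq_of_evalAt_mul_pow 1 ?_
  rw [ratio, evalAt_dehomogenize, map_one, one_mul, pow_one]

theorem aeval_ratio {e : ℕ} (F : forms k n e) (i : Fin (n + 1)) :
    letI := sectionAlgebra (projectiveSpaceOver k n) (chart k i).1
    MvPolynomial.aeval (ratio (k := k) i) F.1 = dehomogenize F i := by
  let _ := sectionAlgebra (projectiveSpaceOver k n) (chart k i).1
  refine eq_of_evalAt_mul_pow e ?_
  set p := genericPt k n
  set φ := algebraMap (MvPolynomial (Fin (n + 1)) k) (PointLocal p)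
  rw [evalAt_dehomogenize, MvPolynomial.aeval_def, MvPolynomial.eval₂_eq', map_sum,
    Finset.sum_mul]
  conv_rhs => rw [F.1.as_sum, map_sum]
  refine Finset.sum_congr rfl fun m hm => ?_
  have hdeg : ∑ j, m j = e := by
    have := F.2 (MvPolynomial.mem_support_iff.1 hm)
    simpa [Finsupp.weight_apply, Finsupp.sum_fintype] using this
  have hpow : φ (coord i) ^ e = ∏ j, φ (coord i) ^ m j := by
    rw [Finset.prod_pow_eq_pow_sum, hdeg]
  rw [map_mul, map_prod, evalAt_sectionAlgebra, hpow, mul_assoc,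
    ← Finset.prod_mul_distrib, MvPolynomial.monomial_eq, map_mul, Finsupp.prod_fintype _ _ (by simp),
    map_prod]
  congr 1
  refine Finset.prod_congr rfl fun j _ => ?_
  rw [map_pow, ← mul_pow, map_pow]
  congr 1
  have := evalAt_dehomogenize (k := k) ⟨coord j, coord_mem j⟩ (genericPt_mem_chart i)
  rw [pow_one] at this
  exact this

theorem adjoin_ratio (i : Fin (n + 1)) :
    letI := sectionAlgebra (projectiveSpaceOver k n) (chart k i).1
    Algebra.adjoin k (Set.range fun j : {j // j ≠ i} => ratio (k := k) i j) = ⊤ := by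
  let _ := sectionAlgebra (projectiveSpaceOver k n) (chart k i).1
  rw [eq_top_iff]
  rintro s -
  obtain ⟨N, P, rfl⟩ := exists_dehomogenize_eq i s
  rw [← aeval_ratio]
  have h : P.1 ∈ Algebra.adjoin k (Set.range (MvPolynomial.X (R := k))) := by
    rw [MvPolynomial.adjoin_range_X]; trivial
  have h2 : MvPolynomial.aeval (ratio (k := k) i) P.1 ∈ (Algebra.adjoin k
      (Set.range (MvPolynomial.X (R := k)))).map (MvPolynomial.aeval (ratio (k := k) i)) :=
    Subalgebra.mem_map.2 ⟨_, h, rfl⟩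
  rw [AlgHom.map_adjoin] at h2
  refine Algebra.adjoin_le ?_ h2
  rintro _ ⟨_, ⟨j, rfl⟩, rfl⟩
  change MvPolynomial.aeval _ _ ∈ _
  rw [MvPolynomial.aeval_X]
  by_cases hj : j = i
  · subst hj
    rw [ratio_self]
    exact one_mem _
  · exact Algebra.subset_adjoin ⟨⟨j, hj⟩, rfl⟩

/-- The quotient of a form by a form that divides it is a form. -/
theorem exists_form_mul_eq {a b : ℕ} {F P : MvPolynomial (Fin (n + 1)) k}
    (hF : F ∈ forms k n a) (hP : P ∈ forms k n b) (hab : a ≤ b) (h : F ∣ P) :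
    ∃ B : forms k n (b - a), P = F * B.1 := by
  obtain ⟨B, rfl⟩ := h
  refine ⟨DirectSum.decompose (forms k n) B (b - a), ?_⟩
  rw [← DirectSum.coe_decompose_mul_of_left_mem_of_le (forms k n) hF hab,
    DirectSum.decompose_of_mem_same _ hP]

theorem _root_.UniqueFactorizationMonoid.dvd_of_forall_dvd_mul {S ι : Type*} [CommRing S]
    [IsDomain S] [UniqueFactorizationMonoid S]
    [Fintype ι] {F : ι → S} (hF : ∀ g, (∀ j, g ∣ F j) → IsUnit g) {a c : S}
    (h : ∀ j, a ∣ F j * c) : a ∣ c := by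
  classical
  let _ : StrongNormalizationMonoid S := UniqueFactorizationMonoid.strongNormalizationMonoid
  let _ : StrongNormalizedGCDMonoid S :=
    UniqueFactorizationMonoid.toStrongNormalizedGCDMonoid S
  have h1 : a ∣ Finset.univ.gcd fun j => F j * c := Finset.dvd_gcd fun j _ => h j
  have h2 : IsUnit (Finset.univ.gcd F) := hF _ fun j => Finset.gcd_dvd (Finset.mem_univ j)
  exact h2.dvd_mul_left.1 (h1.trans (Finset.gcd_mul_right' _ _ c).dvd)

theorem dehomogenize_mul {a b : ℕ} (F : forms k n a) (G : forms k n b) (i : Fin (n + 1)) :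
    dehomogenize F i * dehomogenize G i =
      dehomogenize (e := a + b) ⟨F.1 * G.1, SetLike.mul_mem_graded F.2 G.2⟩ i := by
  refine eq_of_evalAt_mul_pow (a + b) ?_
  rw [evalAt_dehomogenize, map_mul, map_mul, ← evalAt_dehomogenize F (genericPt_mem_chart i),
    ← evalAt_dehomogenize G (genericPt_mem_chart i)]
  ring

theorem dehomogenize_eq_iff {a b : ℕ} (F : forms k n a) (G : forms k n b) (i : Fin (n + 1)) :
    dehomogenize F i = dehomogenize G i ↔ F.1 * coord i ^ b = G.1 * coord i ^ a := by
  rw [← (algebraMap_pointLocal_injective (genericPt k n)).eq_iff, map_mul, map_mul,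
    ← evalAt_dehomogenize F (genericPt_mem_chart i),
    ← evalAt_dehomogenize G (genericPt_mem_chart i), map_pow, map_pow]
  refine ⟨fun h => by rw [h]; ring, fun h => eq_of_evalAt_mul_pow (a + b) ?_⟩
  rw [pow_add, ← mul_assoc, h]
  ring

/-- The coefficients of `ω` on a chart have no common factor. -/
theorem TwistedOneForm.dvd_of_forall_dvd_mul {d : ℕ} (ω : TwistedOneForm k n d)
    (hω : ∀ g : MvPolynomial (Fin (n + 1)) k, (∀ j, g ∣ (ω.coeff j).1) → IsUnit g)
    (i j : Fin (n + 1)) (c : Γ(projectiveSpace k n, (chart k i).1))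
    (h : ∀ l : {l // l ≠ i},
      dehomogenize (ω.coeff j) i ∣ dehomogenize (ω.coeff l) i * c) :
    dehomogenize (ω.coeff j) i ∣ c := by
  obtain ⟨N, C, rfl⟩ := exists_dehomogenize_eq i c
  have h1 (l : {l // l ≠ i}) :
      ∃ M, (ω.coeff j).1 ∣ (ω.coeff l).1 * (coord i ^ M * C.1) := by
    obtain ⟨b, hb⟩ := h l
    obtain ⟨M, B, rfl⟩ := exists_dehomogenize_eq i b
    rw [dehomogenize_mul, dehomogenize_mul, dehomogenize_eq_iff] at hb
    refine ⟨d + 1 + M, B.1 * coord i ^ (d + 1 + N), ?_⟩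
    linear_combination hb
  choose M hM using h1
  obtain ⟨M', hM'⟩ : ∃ M', ∀ l, M l ≤ M' :=
    ⟨∑ l, M l, fun l => Finset.single_le_sum (fun _ _ => zero_le) (Finset.mem_univ l)⟩
  have h2 (l : Fin (n + 1)) (hl : l ≠ i) :
      (ω.coeff j).1 ∣ (ω.coeff l).1 * (coord i ^ M' * C.1) := by
    refine (hM ⟨l, hl⟩).trans (mul_dvd_mul_left _ (mul_dvd_mul_right (pow_dvd_pow _ (hM' _)) _))
  -- The extra factor `x_i` serves the index `l = i`, which is missing on the chart: `x_i F_i` is a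
  -- combination of the other `F_m` by radiality. The factor `x_i ^ (d + 1)` makes the degree large
  -- enough for a quotient form.
  have h3 : (ω.coeff j).1 ∣ (coord i ^ (M' + 1 + (d + 1)) * C.1) := by
    refine UniqueFactorizationMonoid.dvd_of_forall_dvd_mul hω fun l => ?_
    by_cases hl : l = i
    · subst hl
      have h4 : coord l * (ω.coeff l).1 =
          -∑ m ∈ Finset.univ.erase l, coord m * (ω.coeff m).1 := by
        rw [eq_neg_iff_add_eq_zero, ← ω.radial]
        exact Finset.add_sum_erase _ (fun m => coord m * (ω.coeff m).1) (Finset.mem_univ l)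
      have h5 : (ω.coeff l).1 * (coord l ^ (M' + 1 + (d + 1)) * C.1) =
          -∑ m ∈ Finset.univ.erase l,
            (ω.coeff m).1 * (coord l ^ M' * C.1) * (coord m * coord l ^ (d + 1)) := by
        have : (ω.coeff l).1 * (coord l ^ (M' + 1 + (d + 1)) * C.1) =
          (coord l * (ω.coeff l).1) * (coord l ^ M' * C.1 * coord l ^ (d + 1)) := by ring
        rw [this, h4, neg_mul, Finset.sum_mul]
        congr 1
        exact Finset.sum_congr rfl fun m _ => by ring
      rw [h5, dvd_neg]
      exact Finset.dvd_sum fun m hm => (h2 m (Finset.ne_of_mem_erase hm)).mul_right _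
    · refine (h2 l hl).trans (mul_dvd_mul_left _ (mul_dvd_mul_right (pow_dvd_pow _ ?_) _))
      omega
  have hdeg : coord i ^ (M' + 1 + (d + 1)) * C.1 ∈ forms k n (M' + 1 + (d + 1) + N) := by
    refine SetLike.mul_mem_graded (A := forms k n) ?_ C.2
    simpa using SetLike.pow_mem_graded (A := forms k n) (M' + 1 + (d + 1)) (coord_mem i)
  obtain ⟨B, hB⟩ := exists_form_mul_eq (ω.coeff j).2 hdeg (by omega) h3
  refine ⟨dehomogenize B i, ?_⟩
  rw [dehomogenize_mul, dehomogenize_eq_iff]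
  dsimp only
  rw [← hB, show d + 1 + (M' + 1 + (d + 1) + N - (d + 1)) = M' + 1 + (d + 1) + N by omega]
  ring

/-- The ideal of the singular scheme on a chart is contained in the ideal of the zeros of `ω`. -/
theorem ideal_le_span_coeff {d : ℕ} (hn : 1 ≤ n)
    (D : Distribution (projectiveSpaceOver k n) (n - 1)) {ω : TwistedOneForm k n d}
    (hω : ∀ g : MvPolynomial (Fin (n + 1)) k, (∀ j, g ∣ (ω.coeff j).1) → IsUnit g)
    (hD : ∀ (i : Fin (n + 1)) (v : TangentSections (projectiveSpaceOver k n) (chart k i).1),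
      v ∈ D.tangent (chart k i) ↔ ω.contract i v = 0)
    {Z : Scheme.{u}} {f : Z ⟶ projectiveSpace k n} (hZ : D.IsSingularScheme f) (i : Fin (n + 1)) :
    f.ker.ideal (chart k i) ≤
      Ideal.span (Set.range fun j => dehomogenize (ω.coeff j) i) := by
  let _ := sectionAlgebra (projectiveSpaceOver k n) (chart k i).1
  rw [hZ (chart k i)]
  refine (singularIdeal_le (ι := {j // j ≠ i}) (y := fun j => ratio i j)
    (f := fun j => dehomogenize (ω.coeff j) i) ?_ (adjoin_ratio i) ?_ ?_).trans ?_
  · rw [Fintype.card_subtype_compl, Fintype.card_fin, Fintype.card_subtype_eq]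
    omega
  · exact fun j c h => ω.dvd_of_forall_dvd_mul hω i j c h
  · intro v hv
    have := (hD i v).1 hv
    rw [TwistedOneForm.contract, ← Finset.add_sum_erase _ _ (Finset.mem_univ i), ratio_self,
      Derivation.map_one_eq_zero, mul_zero, zero_add] at this
    rw [← this, Finset.sum_subtype (Finset.univ.erase i) (p := fun j => j ≠ i) (by simp)]
  · refine Ideal.span_mono ?_
    rintro _ ⟨j, rfl⟩
    exact ⟨j, rfl⟩

end ProjectiveSpace
end Dist

/-! ### Isolated zeros and a linear form that avoids them. -/

theorem Specializes.eq_of_topologicalKrullDim_nonpos {X : Type*} [TopologicalSpace X] [T0Space X]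
    (h : topologicalKrullDim X ≤ 0) {x y : X} (hxy : x ⤳ y) : x = y := by
  let c (z : X) : TopologicalSpace.IrreducibleCloseds X :=
    ⟨closure {z}, isIrreducible_singleton.closure, isClosed_closure⟩
  have hle : c y ≤ c x := hxy.closure_subset
  have := (Order.krullDim_nonpos_iff_forall_isMax.1 h (c y)) hle
  exact (hxy.antisymm (specializes_iff_closure_subset.2 this)).eq

namespace Dist

section ProjectiveSpace

variable {k : Type u} [Field k] {n : ℕ}

theorem exists_mem_chart (p : projectiveSpace k n) : ∃ i, p ∈ (chart k i).1 := by
  by_contra! H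
  refine ProjectiveSpectrum.not_irrelevant_le (𝒜 := forms k n) p
    ((HomogeneousIdeal.irrelevant_le _).2 fun e he F hF => ?_)
  have hle : originIdeal k (Fin (n + 1)) ≤ pointIdeal p :=
    originIdeal_le fun i => not_not.1 (H i)
  refine hle ?_
  exact MvPolynomial.IsHomogeneous.coeff_eq_zero (φ := F) (n := e) hF (d := 0) (by simpa using he.ne)

/-- A closed subscheme contains the common zeros of forms that generate an ideal containing its
own. -/
theorem mem_range_of_coeff_mem_pointIdeal {Z : Scheme.{u}} {f : Z ⟶ projectiveSpace k n}
    [IsClosedImmersion f] {D : ℕ} {F : Fin (n + 1) → forms k n D}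
    (hf : ∀ i, f.ker.ideal (chart k i) ≤ Ideal.span (Set.range fun j => dehomogenize (F j) i))
    {p : projectiveSpace k n} (hp : ∀ j, (F j).1 ∈ pointIdeal p) : p ∈ Set.range f := by
  obtain ⟨i, hi⟩ := exists_mem_chart p
  have hsupp : p ∈ f.ker.support := by
    rw [Scheme.IdealSheafData.mem_support_iff_of_mem (U := chart k i) hi, Scheme.mem_zeroLocus_iff]
    intro s hs hps
    have hle : Ideal.span (Set.range fun j => dehomogenize (F j) i) ≤
        (IsLocalRing.maximalIdeal (PointLocal p)).comap (evalAt p hi) := by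
      rw [Ideal.span_le]
      rintro _ ⟨j, rfl⟩
      have h1 : evalAt p hi (dehomogenize (F j) i) *
          algebraMap (MvPolynomial (Fin (n + 1)) k) (PointLocal p) (coord i) ^ D ∈
            IsLocalRing.maximalIdeal (PointLocal p) := by
        rw [evalAt_dehomogenize]
        exact (IsLocalization.AtPrime.to_map_mem_maximal_iff _ (pointIdeal p) _).2 (hp j)
      refine (Ideal.IsPrime.mem_or_mem inferInstance h1).resolve_right fun h2 => ?_
      exact hi ((IsLocalization.AtPrime.to_map_mem_maximal_iff _ (pointIdeal p) _).1
        (Ideal.IsPrime.mem_of_pow_mem inferInstance _ h2))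
    exact (IsLocalRing.mem_maximalIdeal _).1 (hle (hf i hs)) (isUnit_evalAt hi hps)
  have h : p ∈ (f.ker.support : Set (projectiveSpace k n)) := hsupp
  rwa [Scheme.Hom.support_ker, f.isClosedEmbedding.isClosed_range.closure_eq] at h

/-- If the zeros of `F_0, …, F_n` are isolated, some linear form has no zero in common with them,
apart from the origin. -/
theorem exists_linear_le_radical [Infinite k] {Z : Scheme.{u}} {f : Z ⟶ projectiveSpace k n}
    [IsClosedImmersion f] (hdim : topologicalKrullDim Z = 0) {D : ℕ} {F : Fin (n + 1) → forms k n D}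
    (hf : ∀ i, f.ker.ideal (chart k i) ≤ Ideal.span (Set.range fun j => dehomogenize (F j) i)) :
    ∃ ℓ : MvPolynomial (Fin (n + 1)) k, ℓ ≠ 0 ∧ ℓ ∈ originIdeal k (Fin (n + 1)) ∧
      originIdeal k (Fin (n + 1)) ≤
        (Ideal.span (insert ℓ (Set.range fun j => (F j).1))).radical := by
  set J := Ideal.span (Set.range fun j => (F j).1) with hJ
  let lin : (Fin (n + 1) → k) →ₗ[k] MvPolynomial (Fin (n + 1)) k :=
    combination fun j => MvPolynomial.X (R := k) j
  have hlin (j) : lin (Pi.single j 1) = MvPolynomial.X j := by simp [lin, combination]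
  have hhom (a) : lin a ∈ forms k n 1 := by
    change combination _ a ∈ _
    rw [combination_apply]
    exact Submodule.sum_mem _ fun j _ => Submodule.smul_mem _ _ (coord_mem j)
  have hinj : Function.Injective lin := by
    rw [injective_iff_map_eq_zero]
    intro w hw
    ext j
    have := congrArg (MvPolynomial.coeff (Finsupp.single j 1)) hw
    change MvPolynomial.coeff _ (combination _ w) = _ at this
    rw [combination_apply, MvPolynomial.coeff_sum] at this
    simpa [MvPolynomial.coeff_X, Finsupp.single_left_inj] using this
  let I := {q : Ideal (MvPolynomial (Fin (n + 1)) k) //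
    q ∈ J.minimalPrimes ∧ ¬ originIdeal k (Fin (n + 1)) ≤ q}
  have : Finite I :=
    ((Ideal.finite_minimalPrimes_of_isNoetherianRing _ J).subset fun q hq => hq.1).to_subtype
  -- A nonzero linear form outside every minimal prime of `J` that does not contain the origin
  -- ideal.
  obtain ⟨a, ha⟩ := Submodule.exists_forall_notMem_of_forall_ne_top
    (fun q : Option I => q.elim ⊥ fun q => (q.1.restrictScalars k).comap lin) (by
      rintro (_ | ⟨q, -, hq⟩)
      · exact bot_ne_top
      · intro htop
        refine hq (originIdeal_le fun j => ?_)
        have : Pi.single j (1 : k) ∈ (q.restrictScalars k).comap lin := by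
          rw [show (q.restrictScalars k).comap lin = ⊤ from htop]
          trivial
        rw [← hlin]
        exact this)
  have ha0 : a ≠ 0 := fun h => ha none (h ▸ zero_mem _)
  refine ⟨lin a, fun h => ha0 (hinj (h.trans (map_zero _).symm)), ?_, ?_⟩
  · exact MvPolynomial.IsHomogeneous.coeff_eq_zero (hhom a) (d := 0) (by simp)
  by_contra hnot
  rw [Ideal.radical_eq_sInf, le_sInf_iff] at hnot
  push Not at hnot
  obtain ⟨P, ⟨hP, hPprime⟩, hPorigin⟩ := hnot
  have hcore (q : Ideal (MvPolynomial (Fin (n + 1)) k)) {G} {e : ℕ} (hG : G ∈ forms k n e)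
      (h : G ∈ q) : G ∈ (q.homogeneousCore (forms k n)).toIdeal :=
    Ideal.mem_homogeneousCore_of_homogeneous_of_mem ⟨e, hG⟩ h
  have hirr (q : Ideal (MvPolynomial (Fin (n + 1)) k))
      (hq : ¬ originIdeal k (Fin (n + 1)) ≤ q) :
      ¬ HomogeneousIdeal.irrelevant (forms k n) ≤ q.homogeneousCore (forms k n) := fun h =>
    hq (originIdeal_le fun j => Ideal.toIdeal_homogeneousCore_le (forms k n) q
      (h (HomogeneousIdeal.mem_irrelevant_of_mem _ one_pos (coord_mem j))))
  have hJP : J ≤ (P.homogeneousCore (forms k n)).toIdeal := Ideal.span_le.2 (by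
    rintro _ ⟨j, rfl⟩
    exact hcore P (F j).2 (hP (Ideal.subset_span (Or.inr ⟨j, rfl⟩))))
  have hPc : (P.homogeneousCore (forms k n)).toIdeal.IsPrime := hPprime.homogeneousCore
  obtain ⟨q, hq, hqP⟩ := Ideal.exists_minimalPrimes_le hJP
  have hqprime : q.IsPrime := hq.1.1
  have hqorigin : ¬ originIdeal k (Fin (n + 1)) ≤ q := fun h =>
    hPorigin (h.trans (hqP.trans (Ideal.toIdeal_homogeneousCore_le _ _)))
  have hJq : J ≤ (q.homogeneousCore (forms k n)).toIdeal := Ideal.span_le.2 (by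
    rintro _ ⟨j, rfl⟩
    exact hcore q (F j).2 (hq.1.2 (Ideal.subset_span ⟨j, rfl⟩)))
  -- A prime `P` over `ℓ` and the `F_j`, but not over the origin ideal, gives a point `y` of `Z`
  -- that specializes from the point `x` of a minimal prime `q`. In dimension zero `x = y`, which
  -- forces `ℓ ∈ q`. Homogeneous cores are used since `q` and `P` are not known to be homogeneous.
  let x : ProjectiveSpectrum (forms k n) :=
    ⟨q.homogeneousCore (forms k n), hqprime.homogeneousCore, hirr q hqorigin⟩
  let y : ProjectiveSpectrum (forms k n) := ⟨P.homogeneousCore (forms k n), hPc, hirr P hPorigin⟩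
  obtain ⟨z, hz⟩ := mem_range_of_coeff_mem_pointIdeal hf (p := x)
    fun j => hJq (Ideal.subset_span ⟨j, rfl⟩)
  obtain ⟨w, hw⟩ := mem_range_of_coeff_mem_pointIdeal hf (p := y)
    fun j => hJP (Ideal.subset_span ⟨j, rfl⟩)
  have hxy : x ⤳ y := by
    rw [specializes_iff_mem_closure, ← ProjectiveSpectrum.le_iff_mem_closure,
      ← ProjectiveSpectrum.as_ideal_le_as_ideal]
    exact (Ideal.toIdeal_homogeneousCore_le (forms k n) q).trans hqP
  have hzw : z ⤳ w := by
    rw [← f.isClosedEmbedding.isInducing.specializes_iff, hz, hw]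
    exact hxy
  have hyx : y = x := by
    rw [← hw, ← hz, hzw.eq_of_topologicalKrullDim_nonpos hdim.le]
  have hmem : lin a ∈ y.asHomogeneousIdeal.toIdeal :=
    hcore P (hhom a) (hP (Ideal.subset_span (Or.inl rfl)))
  rw [hyx] at hmem
  exact ha (some ⟨q, hq, hqorigin⟩) (Ideal.toIdeal_homogeneousCore_le (forms k n) q hmem)

/-! ### From local sections back to forms. -/

/-- If a form is in an ideal after dehomogenization, then it is in the saturation of this ideal. -/
theorem exists_pow_mul_mem_span {D e : ℕ} {F : Fin (n + 1) → forms k n D} {G : forms k n e}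
    {i : Fin (n + 1)}
    (h : dehomogenize G i ∈ Ideal.span (Set.range fun j => dehomogenize (F j) i)) :
    ∃ N : ℕ, coord i ^ N * G.1 ∈ Ideal.span (Set.range fun j => (F j).1) := by
  set α := algebraMap (MvPolynomial (Fin (n + 1)) k) (PointLocal (genericPt k n))
  have key (s) (hs : s ∈ Ideal.span (Set.range fun j => dehomogenize (F j) i)) :
      ∃ N : ℕ, ∃ P ∈ Ideal.span (Set.range fun j => (F j).1),
        evalAt (genericPt k n) (genericPt_mem_chart i) s * α (coord i) ^ N = α P := by
    induction hs using Submodule.span_induction with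
    | mem s hs =>
      obtain ⟨j, rfl⟩ := hs
      exact ⟨D, (F j).1, Ideal.subset_span ⟨j, rfl⟩, evalAt_dehomogenize _ _⟩
    | zero => exact ⟨0, 0, zero_mem _, by simp⟩
    | add s t _ _ hs ht =>
      obtain ⟨N, P, hP, h1⟩ := hs
      obtain ⟨M, Q, hQ, h2⟩ := ht
      refine ⟨N + M, P * coord i ^ M + Q * coord i ^ N,
        add_mem (Ideal.mul_mem_right _ _ hP) (Ideal.mul_mem_right _ _ hQ), ?_⟩
      rw [map_add, map_add, map_mul, map_mul, ← h1, ← h2, map_pow, map_pow]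
      ring
    | smul a s _ hs =>
      obtain ⟨N, P, hP, h1⟩ := hs
      obtain ⟨M, A, rfl⟩ := exists_dehomogenize_eq i a
      refine ⟨M + N, A.1 * P, Ideal.mul_mem_left _ _ hP, ?_⟩
      rw [smul_eq_mul, map_mul, map_mul, ← h1,
        ← evalAt_dehomogenize A (genericPt_mem_chart i)]
      ring
  obtain ⟨N, P, hP, hN⟩ := key _ h
  refine ⟨N, ?_⟩
  have : coord i ^ N * G.1 = P * coord i ^ e := by
    apply algebraMap_pointLocal_injective (genericPt k n)
    rw [map_mul, map_mul, ← evalAt_dehomogenize G (genericPt_mem_chart i), ← hN, map_pow, map_pow]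
    ring
  rw [this]
  exact Ideal.mul_mem_right _ _ hP

/-- The sections of a twist of an ideal sheaf are given by forms. -/
theorem exists_form_of_mem_twistedSections (hn : 1 ≤ n) {I : (projectiveSpace k n).IdealSheafData}
    {e : ℕ} {s : ∀ i : Fin (n + 1), Γ(projectiveSpace k n, (chart k i).1)}
    (hs : s ∈ twistedSections I e) : ∃ G : forms k n e, ∀ i, s i = dehomogenize G i := by
  have hrel {i j : Fin (n + 1)} {a b : ℕ} {P : forms k n a} {Q : forms k n b}
      (hP : dehomogenize P i = s i) (hQ : dehomogenize Q j = s j) :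
      P.1 * coord i ^ e * coord j ^ b = coord j ^ e * Q.1 * coord i ^ a := by
    have hmem : genericPt k n ∈ (chart k i).1 ⊓ (chart k j).1 :=
      ⟨genericPt_mem_chart i, genericPt_mem_chart j⟩
    have h1 := congrArg (evalAt (genericPt k n) hmem) (hs.2 i j)
    rw [map_mul, map_pow, evalAt_res, evalAt_res, evalAt_res, ← hP, ← hQ] at h1
    have h2 := evalAt_dehomogenize (k := k) ⟨coord j, coord_mem j⟩ (genericPt_mem_chart i)
    rw [pow_one] at h2
    change evalAt _ _ (ratio i j) * _ = _ at h2
    apply algebraMap_pointLocal_injective (genericPt k n)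
    simp only [map_mul, map_pow]
    rw [← evalAt_dehomogenize P (genericPt_mem_chart i),
      ← evalAt_dehomogenize Q (genericPt_mem_chart j), h1, ← h2]
    ring
  have hform (i) : ∃ G : forms k n e, dehomogenize G i = s i := by
    -- A second chart, available as `n ≥ 1`, excludes poles along `x_i = 0`: in the cleared gluing
    -- relation `x_i ^ a` is prime to `x_j ^ b`.
    obtain ⟨j, hij⟩ : ∃ j, j ≠ i := by
      have : Nontrivial (Fin (n + 1)) := Fin.nontrivial_iff_two_le.2 (by omega)
      exact exists_ne i
    obtain ⟨a, P, hP⟩ := exists_dehomogenize_eq i (s i)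
    obtain ⟨b, Q, hQ⟩ := exists_dehomogenize_eq j (s j)
    have hdvd : coord i ^ a ∣ P.1 * coord i ^ e := by
      have hprime : Prime (coord i : MvPolynomial (Fin (n + 1)) k) := MvPolynomial.X_prime
      refine (hprime.pow_dvd_of_dvd_mul_right (b := coord j ^ b) a (fun h => ?_)
        ⟨coord j ^ e * Q.1, by rw [hrel hP hQ, mul_comm]⟩)
      have := hprime.dvd_of_dvd_pow h
      rw [MvPolynomial.X_dvd_X] at this
      exact hij this.symm
    have hmem (c : ℕ) : coord i ^ c ∈ forms k n c := by
      simpa using SetLike.pow_mem_graded (A := forms k n) c (coord_mem i)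
    obtain ⟨G, hG⟩ := exists_form_mul_eq (hmem a)
      (SetLike.mul_mem_graded (A := forms k n) P.2 (hmem e)) (Nat.le_add_right a e) hdvd
    refine ⟨⟨G.1, by simpa using G.2⟩, ?_⟩
    rw [← hP, dehomogenize_eq_iff, hG, mul_comm]
  choose G hG using hform
  refine ⟨G 0, fun i => ?_⟩
  rw [← hG i]
  congr 1
  have := hrel (hG i) (hG 0)
  apply Subtype.ext
  have hne (j : Fin (n + 1)) : (coord j ^ e : MvPolynomial (Fin (n + 1)) k) ≠ 0 :=
    pow_ne_zero _ (MvPolynomial.X_ne_zero j)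
  refine mul_right_cancel₀ (hne i) (mul_right_cancel₀ (hne 0) ?_)
  rw [this]
  ring

end ProjectiveSpace
end Dist

/-! ### The theorem. -/

theorem mainTheorem8 {k : Type u} [Field k] [IsAlgClosed k] {n d : ℕ} (hn : 1 ≤ n) (hd : 1 ≤ d)
    (D : Dist.Distribution (Dist.projectiveSpaceOver k n) (n - 1)) (hD : D.HasDegree d)
    {Z : Scheme.{u}} (i : Z ⟶ Dist.projectiveSpace k n) [IsClosedImmersion i]
    (hZ : D.IsSingularScheme i) (hdim : topologicalKrullDim Z = 0) :
    Dist.twistedSections i.ker d = ⊥ ∧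
      ∀ e : ℕ, e ≤ d → ∀ F : Dist.forms k n e, F ≠ 0 →
        ¬ Dist.IsContainedInHypersurface i.ker F := by
  obtain ⟨ω, hω, hωD⟩ := hD
  have : Infinite k := IsAlgClosed.instInfinite
  have hle := Dist.ideal_le_span_coeff hn D hω hωD hZ
  obtain ⟨ℓ, hℓ0, hℓ, hrad⟩ := Dist.exists_linear_le_radical hdim hle
  have key (G : Dist.forms k n d)
      (hG : ∀ j, Dist.dehomogenize G j ∈ i.ker.ideal (Dist.chart k j)) : G = 0 :=
    Subtype.ext (Dist.eq_zero_of_pow_mul_mem_span hd hℓ0 hℓ (fun j => (ω.coeff j).2) hrad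
      ω.radial hω G.2 fun j => Dist.exists_pow_mul_mem_span (hle j (hG j)))
  refine ⟨(AddSubgroup.eq_bot_iff_forall _).2 fun s hs => ?_, fun e he F hF hcont => hF ?_⟩
  · obtain ⟨G, hG⟩ := Dist.exists_form_of_mem_twistedSections hn hs
    obtain rfl := key G fun j => hG j ▸ hs.1 j
    funext j
    rw [hG, Dist.dehomogenize_zero]
    rfl
  -- Multiplication by `x_0 ^ (d - e)` reduces to degree `d`.
  · obtain ⟨c, rfl⟩ := Nat.exists_eq_add_of_le' he
    have hX : Dist.coord 0 ^ c ∈ Dist.forms k n c := by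
      simpa using SetLike.pow_mem_graded (A := Dist.forms k n) c (Dist.coord_mem 0)
    have h0 := key ⟨_, SetLike.mul_mem_graded (A := Dist.forms k n) hX F.2⟩ fun j => by
      rw [← Dist.dehomogenize_mul ⟨_, hX⟩ F j]
      exact Ideal.mul_mem_left _ _ (hcont j)
    exact Subtype.ext ((mul_eq_zero.1 (congrArg Subtype.val h0)).resolve_left
      (pow_ne_zero _ (MvPolynomial.X_ne_zero 0)))
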